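/- Let $K$ be a partial computable function from binary strings to natural numbers such that $\sum_{x\in\operatorname{dom}K} 2^{-K(x)}<1$. Then there exists an oracle machine $M$ with the following property: for every infinite bit sequence $\alpha$ such that $K(\alpha\upharpoonright n)$ is defined for all $n\ge 0$ (where $\alpha\upharpoonright n$ denotes the prefix of $\alpha$ of length $n$), there exists a Martin-Löf random infinite bit sequence $\beta$ such that $M$ with oracle $\beta$ computes $\alpha$, and for every $n$ the oracle use when computing the prefix $\alpha\upharpoonright n$ is at most $K(\alpha\upharpoonright n)$. Here an oracle machine reads the bits of its oracle one by one from left to right, performs other computations in between, and writes its output bit by bit; $M$ with oracle $\beta$ computes $\alpha$ if the sequence of all output bits is the infinite sequence $\alpha$. The oracle use on $\alpha\upharpoonright n$ is the number of oracle bits read up to the first moment when $n$ output bits have been produced. A sequence is Martin-Löf random if for every uniformly computably enumerable sequence $W_0,W_1,\dots$ of sets of binary strings such that, for each $n$, the set of infinite sequences with a prefix in $W_n$ has uniform measure at most $2^{-n}$, there is an $n$ such that the sequence has no prefix in $W_n$. -/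

import Mathlib

open scoped ENNReal

noncomputable section

namespace RandomReduction

/-- The prefix `α ↾ n` of length `n` of a bit sequence. -/
def initSeg (α : ℕ → Bool) (n : ℕ) : List Bool :=
  (List.range n).map α

/-! ### Oracle machines

The machine reads the oracle bit by bit (each bit once, from left to right), performs
other computations in between, and writes its output bit by bit. -/

/-- What a machine does in a given state: it computes without touching the tapes and goes to
state `q`; or reads the next oracle bit and goes to `q₀` or `q₁` according to its value;
or writes the bit `b` at the end of the output and goes to `q`. -/
inductive Instr : Type
  | compute (q : ℕ) : Instr
  | read (q₀ q₁ : ℕ) : Instr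
  | write (b : Bool) (q : ℕ) : Instr

/-- The coding of instructions, used to say that a function into `Instr` is computable. -/
def Instr.equivSum : Instr ≃ ℕ ⊕ (ℕ × ℕ) ⊕ (Bool × ℕ) where
  toFun
    | .compute q => .inl q
    | .read q₀ q₁ => .inr (.inl (q₀, q₁))
    | .write b q => .inr (.inr (b, q))
  invFun
    | .inl q => .compute q
    | .inr (.inl p) => .read p.1 p.2
    | .inr (.inr p) => .write p.1 p.2
  left_inv i := by cases i <;> rfl
  right_inv s := by rcases s with _ | _ | _ <;> rfl

instance : Primcodable Instr := Primcodable.ofEquiv _ Instr.equivSum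

/-- An oracle machine. Its states (which comprise the contents of all work tapes) are coded by
natural numbers, and the instruction executed in a state is a computable function of the state. -/
structure OracleMachine where
  start : ℕ
  instr : ℕ → Instr
  computable_instr : Computable instr

/-- A configuration: the current state, the number of oracle bits that have been read so far, and
the output written so far. -/
structure Config where
  state : ℕ
  bitsRead : ℕ
  output : List Bool

namespace OracleMachine

/-- One step of the machine `M` with oracle `β`. -/
def step (M : OracleMachine) (β : ℕ → Bool) (c : Config) : Config :=
  match M.instr c.state with
  | .compute q => ⟨q, c.bitsRead, c.output⟩
  | .read q₀ q₁ => ⟨if β c.bitsRead then q₁ else q₀, c.bitsRead + 1, c.output⟩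
  | .write b q => ⟨q, c.bitsRead, c.output ++ [b]⟩

/-- The configuration of `M` with oracle `β` after `t` steps. -/
def run (M : OracleMachine) (β : ℕ → Bool) (t : ℕ) : Config :=
  (M.step β)^[t] ⟨M.start, 0, []⟩

/-- `M` with oracle `β` computes the (infinite) sequence `α`: everything that is ever written is a
prefix of `α`, and arbitrarily long prefixes are written. -/
def Computes (M : OracleMachine) (β α : ℕ → Bool) : Prop :=
  (∀ t, (M.run β t).output = initSeg α (M.run β t).output.length) ∧
    ∀ n, ∃ t, n ≤ (M.run β t).output.length

/-- The oracle use of `M` with oracle `β` on the output prefix of length `n`: the number of oracle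
bits that have been read up to the first moment when `n` output bits have been produced. It is
undefined if fewer than `n` bits are ever produced. -/
def oracleUse (M : OracleMachine) (β : ℕ → Bool) (n : ℕ) : Part ℕ where
  Dom := ∃ t, n ≤ (M.run β t).output.length
  get h := (M.run β (Nat.find h)).bitsRead

end OracleMachine

/-! ### Martin-Löf randomness -/

/-- The uniform (fair coin) measure on the Cantor space. -/
def coinMeasure : MeasureTheory.Measure (ℕ → Bool) :=
  MeasureTheory.Measure.infinitePi fun _ : ℕ => (PMF.uniformOfFintype Bool).toMeasure

/-- The open set generated by a set of strings: all sequences with a prefix in the set. -/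
def openSet (W : Set (List Bool)) : Set (ℕ → Bool) :=
  {β | ∃ n, initSeg β n ∈ W}

/-- A Martin-Löf test: a uniformly computably enumerable sequence of sets of strings `W 0, W 1, …`
such that the open set generated by `W n` has uniform measure at most `2 ^ (-n)`. -/
def IsMartinLofTest (W : ℕ → Set (List Bool)) : Prop :=
  REPred (fun p : ℕ × List Bool => p.2 ∈ W p.1) ∧
    ∀ n, coinMeasure (openSet (W n)) ≤ (2⁻¹ : ℝ≥0∞) ^ n

/-- A sequence is Martin-Löf random if it passes every Martin-Löf test. -/
def IsMartinLofRandom (β : ℕ → Bool) : Prop :=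
  ∀ W : ℕ → Set (List Bool), IsMartinLofTest W → ∃ n, β ∉ openSet (W n)

end RandomReduction

end

/-! Choose `c` so that 2^(-c) is below the gap between 1 and the sum. A union `U` of truncated tests
is c.e., has measure at most 2^(-c), and leaves only random sequences outside
(`isMartinLofRandom_of_notMem`). It remains to find β outside `U` from which α can be decoded.

Strings are allocated online. Cantor space is divided into cells, each owned by a string; at first
the empty string owns everything, and cells found to be covered by `U` are dropped. When K is known
on x and all its prefixes, and x owns no cell, a cell of a proper prefix of x is split: a piece of
length K(x) goes to x, and each remainder goes to the longest proper prefix for which it is small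
enough, the old owner being the fallback.

This never gets stuck. The cells of one owner have distinct lengths and, for a nonempty owner o,
total weight at most 2^(-K(o)); splitting the best cell preserves this (`IsSpaced.split`). If no
cell could be split, an exchange argument along the prefixes of x would bound the weight of all
cells by the given sum (`IsSpaced.sum_le_tsum`), although the cells and `U` cover the space.

A split in favour of x assigns to each prefix y of x beyond the old owner an initial part of the
string given to x, of length the minimum of K over the prefixes of x extending y, hence at most
K(y). These strings nest (`exists_chunk_prefix`), and comparable ones assigned to strings of the
same length coincide (`eq_of_chunk`), so `follower` can read α off β. Some string assigned to x is
not covered by `U`: otherwise x would receive new strings for ever, but only finitely many have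
length at most K(x) (`exists_chunk_not_subset`). Compactness gives one β for all prefixes of α
(`exists_oracle`). -/

noncomputable section

namespace RandomReduction

open MeasureTheory
open Nat.Partrec (Code)
open Encodable (encode decode)

/-! ### Initial segments and cylinders -/

@[simp] lemma length_initSeg (β : ℕ → Bool) (n : ℕ) : (initSeg β n).length = n := by
  simp [initSeg]

lemma initSeg_succ (β : ℕ → Bool) (n : ℕ) : initSeg β (n + 1) = initSeg β n ++ [β n] := by
  simp [initSeg, List.range_succ]

lemma take_initSeg (β : ℕ → Bool) {m n : ℕ} (h : m ≤ n) :
    (initSeg β n).take m = initSeg β m := by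
  simp [initSeg, ← List.map_take, List.take_range, h]

lemma initSeg_prefix (β : ℕ → Bool) {m n : ℕ} (h : m ≤ n) : initSeg β m <+: initSeg β n :=
  take_initSeg β h ▸ List.take_prefix _ _

/-- The set of all sequences that extend the string `v`. -/
def cyl (v : List Bool) : Set (ℕ → Bool) := {β | initSeg β v.length = v}

lemma mem_cyl {v : List Bool} {β : ℕ → Bool} : β ∈ cyl v ↔ initSeg β v.length = v := Iff.rfl

lemma mem_cyl_initSeg (β : ℕ → Bool) (n : ℕ) : β ∈ cyl (initSeg β n) := by
  simp [mem_cyl]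

lemma prefix_initSeg_iff {v : List Bool} {β : ℕ → Bool} {n : ℕ} :
    v <+: initSeg β n ↔ v.length ≤ n ∧ β ∈ cyl v := by
  constructor
  · intro h
    have hl : v.length ≤ n := by simpa using h.length_le
    refine ⟨hl, ?_⟩
    rw [mem_cyl, ← take_initSeg β hl]
    exact (List.prefix_iff_eq_take.1 h).symm
  · rintro ⟨h, hv⟩
    rw [mem_cyl] at hv
    rw [← hv]
    exact initSeg_prefix β h

lemma cyl_anti {u v : List Bool} (h : u <+: v) : cyl v ⊆ cyl u := by
  intro β hβ
  rw [mem_cyl] at hβ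
  exact (prefix_initSeg_iff.1 (hβ.symm ▸ h : u <+: initSeg β v.length)).2

lemma prefix_of_mem_cyl {u v : List Bool} {β : ℕ → Bool} (hu : β ∈ cyl u) (hv : β ∈ cyl v)
    (h : u.length ≤ v.length) : u <+: v := by
  rw [mem_cyl] at hv
  rw [← hv]
  exact prefix_initSeg_iff.2 ⟨h, hu⟩

lemma mem_openSet {W : Set (List Bool)} {β : ℕ → Bool} :
    β ∈ openSet W ↔ ∃ v ∈ W, β ∈ cyl v := by
  constructor
  · rintro ⟨n, hn⟩
    exact ⟨_, hn, mem_cyl_initSeg β n⟩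
  · rintro ⟨v, hv, hβ⟩
    rw [mem_cyl] at hβ
    exact ⟨v.length, hβ.symm ▸ hv⟩

lemma exists_mem_cyl (v : List Bool) : (cyl v).Nonempty := by
  refine ⟨fun i => v.getD i false, ?_⟩
  rw [mem_cyl]
  apply List.ext_getElem
  · simp
  · intro i h₁ h₂
    simp [initSeg, h₂]

lemma cyl_nil : cyl [] = Set.univ := by
  ext β; simp [mem_cyl, initSeg]

lemma cyl_eq_pi (v : List Bool) :
    cyl v = (↑(Finset.range v.length) : Set ℕ).pi fun i => {v.getD i false} := by
  ext β
  simp only [mem_cyl, Set.mem_pi, Finset.mem_coe, Finset.mem_range, Set.mem_singleton_iff]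
  constructor
  · intro h i hi
    have : (initSeg β v.length)[i]'(by simpa using hi) = v[i] := by simp [h]
    simpa [initSeg, hi] using this
  · intro h
    apply List.ext_getElem
    · simp
    · intro i h₁ h₂
      simpa [initSeg, h₂] using h i h₂

lemma isClopen_cyl (v : List Bool) : IsClopen (cyl v) := by
  rw [cyl_eq_pi]
  refine ⟨isClosed_set_pi fun i _ => isClosed_discrete _, isOpen_set_pi (Finset.finite_toSet _)
    fun i _ => isOpen_discrete _⟩

lemma measurableSet_cyl (v : List Bool) : MeasurableSet (cyl v) := by
  rw [cyl_eq_pi]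
  exact MeasurableSet.pi (Set.to_countable _) fun i _ => MeasurableSet.of_discrete

lemma isCompact_cyl (v : List Bool) : IsCompact (cyl v) := (isClopen_cyl v).1.isCompact

lemma openSet_eq_biUnion (W : Set (List Bool)) : openSet W = ⋃ v ∈ W, cyl v := by
  ext β; simp [mem_openSet]

lemma isOpen_openSet (W : Set (List Bool)) : IsOpen (openSet W) := by
  rw [openSet_eq_biUnion]
  exact isOpen_biUnion fun v _ => (isClopen_cyl v).2

lemma openSet_mono {V W : Set (List Bool)} (h : V ⊆ W) : openSet V ⊆ openSet W :=
  fun _ ⟨n, hn⟩ => ⟨n, h hn⟩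

instance : IsProbabilityMeasure coinMeasure := by
  unfold coinMeasure; infer_instance

lemma coinMeasure_cyl (v : List Bool) : coinMeasure (cyl v) = (2⁻¹ : ℝ≥0∞) ^ v.length := by
  rw [cyl_eq_pi, coinMeasure, Measure.infinitePi_pi]
  · simp
  · intro i _; exact MeasurableSet.of_discrete

/-! ### The list of all strings of given length -/

/-- The list of all strings of length `n`. -/
def words (n : ℕ) : List (List Bool) :=
  Nat.rec [[]] (fun _ L => L.flatMap fun w => [w ++ [false], w ++ [true]]) n

lemma words_succ (n : ℕ) :
    words (n + 1) = (words n).flatMap fun w => [w ++ [false], w ++ [true]] := rfl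

lemma mem_words {n : ℕ} : ∀ {w : List Bool}, w ∈ words n ↔ w.length = n := by
  induction n with
  | zero => intro w; simp [words]
  | succ n ih =>
    intro w
    rw [words_succ]
    simp only [List.mem_flatMap, ih, List.mem_cons, List.not_mem_nil, or_false]
    constructor
    · rintro ⟨u, hu, rfl | rfl⟩ <;> simp [hu]
    · intro h
      have hne : w ≠ [] := by rintro rfl; simp at h
      refine ⟨w.dropLast, by simp [h], ?_⟩
      have := List.dropLast_append_getLast hne
      cases hb : w.getLast hne
      · left; rw [hb] at this; exact this.symm
      · right; rw [hb] at this; exact this.symm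

lemma nodup_words (n : ℕ) : (words n).Nodup := by
  induction n with
  | zero => simp [words]
  | succ n ih =>
    rw [words_succ, List.nodup_flatMap]
    refine ⟨fun w _ => by simp, ih.imp ?_⟩
    intro a b hab
    simp [Function.onFun, List.disjoint_left, hab]

/-! ### Primitive recursive predicates and functions -/

section Primrec

variable {α β : Type*} [Primcodable α] [Primcodable β]

lemma _root_.PrimrecRel.forall_mem {f : α → List β} {p : α → β → Prop} (hf : Primrec f)
    (hp : PrimrecRel p) : PrimrecPred fun a => ∀ b ∈ f a, p a b :=
  (PrimrecRel.forall_mem_list hp.swap).comp hf Primrec.id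

lemma _root_.PrimrecRel.exists_mem {f : α → List β} {p : α → β → Prop} (hf : Primrec f)
    (hp : PrimrecRel p) : PrimrecPred fun a => ∃ b ∈ f a, p a b :=
  (PrimrecRel.exists_mem_list hp.swap).comp hf Primrec.id

lemma _root_.PrimrecRel.forall_range {f : α → ℕ} {p : α → ℕ → Prop} (hf : Primrec f)
    (hp : PrimrecRel p) : PrimrecPred fun a => ∀ i < f a, p a i :=
  (PrimrecRel.forall_mem (Primrec.list_range.comp hf) hp).of_eq (by simp)

lemma _root_.PrimrecRel.exists_range {f : α → ℕ} {p : α → ℕ → Prop} (hf : Primrec f)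
    (hp : PrimrecRel p) : PrimrecPred fun a => ∃ i < f a, p a i :=
  (PrimrecRel.exists_mem (Primrec.list_range.comp hf) hp).of_eq (by simp)

lemma _root_.PrimrecRel.filter {f : α → List β} {p : α → β → Prop} [∀ a, DecidablePred (p a)]
    (hf : Primrec f) (hp : PrimrecRel p) :
    Primrec fun a => (f a).filter fun b => decide (p a b) := by
  classical
  refine ((PrimrecRel.listFilter hp.swap).comp hf Primrec.id).of_eq fun a => ?_
  simp only [id]

lemma primrec_replicate : Primrec fun n : ℕ => List.replicate n false :=
  (Primrec.list_map Primrec.list_range (Primrec.const false).to₂).of_eq fun n => by simp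

lemma primrecRel_prefix : PrimrecRel fun u v : List Bool => u <+: v :=
  PrimrecPred.of_eq (Primrec.eq.comp Primrec.fst
    (Primrec.list_take.comp (Primrec.list_length.comp Primrec.fst) Primrec.snd))
    fun _ => List.prefix_iff_eq_take.symm

lemma primrec_words : Primrec words :=
  Primrec.nat_rec₁ _ (Primrec.to₂ (Primrec.list_flatMap Primrec.snd
    (Primrec.to₂ (Primrec.list_cons.comp
      (Primrec.list_append.comp Primrec.snd (Primrec.const _))
      (Primrec.list_cons.comp (Primrec.list_append.comp Primrec.snd (Primrec.const _))
        (Primrec.const _))))))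

lemma rePred_exists {p : α → ℕ → Prop} (hp : PrimrecRel p) : REPred fun a => ∃ n, p a n := by
  classical
  have h : Primrec₂ fun a n => decide (p a n) := hp.decide
  have := (Partrec.rfind (p := fun a n => (Part.some (decide (p a n)) : Part Bool))
    h.to_comp.partrec₂).dom_re
  refine this.of_eq fun a => ?_
  refine Nat.rfind_dom.trans ?_
  simp

end Primrec

/-! ### Stages of enumeration -/

lemma exists_code_eval {α σ : Type*} [Primcodable α] [Primcodable σ] {f : α →. σ}
    (hf : Partrec f) : ∃ c : Code, ∀ a, c.eval (encode a) = (f a).map encode := by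
  obtain ⟨c, hc⟩ := Code.exists_code.1 hf
  exact ⟨c, fun a => by rw [hc]; simp⟩

lemma isSome_evaln_mono {m n : ℕ} (h : m ≤ n) {c : Code} {x : ℕ}
    (hx : (Code.evaln m c x).isSome) : (Code.evaln n c x).isSome := by
  obtain ⟨v, hv⟩ := Option.isSome_iff_exists.1 hx
  exact Option.isSome_iff_exists.2 ⟨v, Code.evaln_mono h hv⟩

lemma dom_eval_iff {c : Code} {x : ℕ} :
    (c.eval x).Dom ↔ ∃ n, (Code.evaln n c x).isSome := by
  rw [Part.dom_iff_mem]
  simp only [Code.evaln_complete, Option.isSome_iff_exists, Option.mem_def]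
  exact exists_comm

/-- Every r.e. predicate is the union of an increasing sequence of primitive recursive ones. -/
lemma exists_stages {α : Type*} [Primcodable α] {p : α → Prop} (hp : REPred p) :
    ∃ q : ℕ → α → Prop, PrimrecRel q ∧ (∀ m n a, m ≤ n → q m a → q n a) ∧
      ∀ a, p a ↔ ∃ n, q n a := by
  obtain ⟨c, hc⟩ := exists_code_eval hp
  refine ⟨fun n a => (Code.evaln n c (encode a)).isSome, ?_,
    fun m n a h => isSome_evaln_mono h, fun a => ?_⟩
  · refine Primrec.eq.comp (Primrec.option_isSome.comp (Code.primrec_evaln.comp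
      (Primrec.pair (Primrec.pair Primrec.fst (Primrec.const c))
        (Primrec.encode.comp Primrec.snd)))) (Primrec.const true)
  · rw [← dom_eval_iff, hc]
    simp [Part.assert]

/-! ### A universal Martin-Löf test -/

open Classical in
-- Strings of length at most `t` generate a disjoint union of cylinders of length exactly `t`. The
-- measure is thus a count, which makes the smallness of a stage decidable.
lemma coinMeasure_openSet_eq_count {P : Set (List Bool)} {t : ℕ} (hP : ∀ v ∈ P, v.length ≤ t) :
    coinMeasure (openSet P) =
      ((words t).filter fun w => decide (∃ i < w.length + 1, w.take i ∈ P)).length *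
        (2⁻¹ : ℝ≥0∞) ^ t := by
  set L := (words t).filter fun w => decide (∃ i < w.length + 1, w.take i ∈ P) with hL
  have hlen : ∀ w ∈ L, w.length = t := fun w hw => mem_words.1 (List.mem_of_mem_filter hw)
  have hnd : L.Nodup := (nodup_words t).filter _
  have hU : openSet P = ⋃ w ∈ L.toFinset, cyl w := by
    ext β
    simp only [mem_openSet, Set.mem_iUnion, List.mem_toFinset, exists_prop]
    constructor
    · rintro ⟨v, hv, hβ⟩
      refine ⟨initSeg β t, ?_, mem_cyl_initSeg β t⟩
      rw [hL, List.mem_filter]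
      refine ⟨mem_words.2 (by simp), decide_eq_true ⟨v.length, ?_, ?_⟩⟩
      · have := hP v hv
        simp; omega
      · rw [take_initSeg β (hP v hv)]
        rw [mem_cyl] at hβ
        rwa [hβ]
    · rintro ⟨w, hw, hβ⟩
      rw [hL, List.mem_filter] at hw
      obtain ⟨i, -, hi⟩ := of_decide_eq_true hw.2
      exact ⟨_, hi, cyl_anti (List.take_prefix _ _) hβ⟩
  rw [hU, measure_biUnion_finset]
  · rw [Finset.sum_congr rfl fun w hw => by
      rw [coinMeasure_cyl, hlen w (List.mem_toFinset.1 hw)]]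
    rw [Finset.sum_const, List.toFinset_card_of_nodup hnd, nsmul_eq_mul]
  · intro u hu v hv huv
    rw [Function.onFun, Set.disjoint_left]
    intro β hβu hβv
    simp only [List.coe_toFinset, Set.mem_ofPred_eq] at hu hv
    apply huv
    have := prefix_of_mem_cyl hβu hβv (by rw [hlen u hu, hlen v hv])
    exact this.eq_of_length (by rw [hlen u hu, hlen v hv])
  · exact fun w _ => measurableSet_cyl w

section Universal

variable (c : ℕ)

/-- `testStage c e t` is the part enumerated in `t` steps of the component `e + c + 1` of the
sequence of sets of strings with the index `e`. -/
def testStage (e t : ℕ) : Set (List Bool) :=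
  {v | v.length < t + 1 ∧
    (Code.evaln t (Denumerable.ofNat Code e) (encode (e + c + 1, v))).isSome}

lemma testStage_mono (e : ℕ) : Monotone (testStage c e) :=
  fun _ _ h _ hv => ⟨by have := hv.1; omega, isSome_evaln_mono h hv.2⟩

open Classical in
/-- The set of sequences generated by the stage `t` of the test with index `e` is small. -/
def testSmall (e t : ℕ) : Prop :=
  2 ^ (e + c + 1) *
    ((words t).filter fun w => decide (∃ i < w.length + 1, w.take i ∈ testStage c e t)).length
      ≤ 2 ^ t

open Classical in
lemma testSmall_iff (e t : ℕ) :
    testSmall c e t ↔ coinMeasure (openSet (testStage c e t)) ≤ (2⁻¹ : ℝ≥0∞) ^ (e + c + 1) := by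
  rw [coinMeasure_openSet_eq_count (t := t) fun v hv => Nat.lt_succ_iff.1 hv.1, testSmall]
  generalize List.length _ = k
  rw [← ENNReal.inv_pow, ← ENNReal.inv_pow, ← div_eq_mul_inv, ENNReal.div_le_iff (by simp) (by simp),
    mul_comm (_⁻¹), ← div_eq_mul_inv, ENNReal.le_div_iff_mul_le (by simp) (by simp), mul_comm]
  exact_mod_cast Iff.rfl

/-- The union of all truncated tests. -/
def universalSet : Set (List Bool) :=
  {v | ∃ e t, testSmall c e t ∧ v ∈ testStage c e t}

lemma primrec_two_pow : Primrec fun n : ℕ => 2 ^ n :=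
  (Primrec.nat_rec₁ (f := fun _ r => r * 2) 1 (Primrec.to₂
    (Primrec.nat_mul.comp Primrec.snd (Primrec.const 2)))).of_eq fun n => by
      induction n with
      | zero => rfl
      | succ n ih => rw [pow_succ, ← ih]

lemma primrec_testStage :
    PrimrecPred fun p : (ℕ × ℕ) × List Bool => p.2 ∈ testStage c p.1.1 p.1.2 := by
  refine PrimrecPred.and (Primrec.nat_lt.comp (Primrec.list_length.comp Primrec.snd)
    (Primrec.succ.comp (Primrec.snd.comp Primrec.fst))) ?_
  refine Primrec.eq.comp (Primrec.option_isSome.comp (Code.primrec_evaln.comp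
    (Primrec.pair (Primrec.pair (Primrec.snd.comp Primrec.fst)
      ((Primrec.ofNat Code).comp (Primrec.fst.comp Primrec.fst)))
        (Primrec.encode.comp (Primrec.pair
          (Primrec.nat_add.comp (Primrec.fst.comp Primrec.fst) (Primrec.const (c + 1)))
            Primrec.snd))))) (Primrec.const true)

open Classical in
lemma primrec_testSmall : PrimrecRel fun e t : ℕ => testSmall c e t := by
  unfold testSmall
  refine Primrec.nat_le.comp (Primrec.nat_mul.comp
    (primrec_two_pow.comp (Primrec.succ.comp (Primrec.nat_add.comp Primrec.fst (Primrec.const c))))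
    (Primrec.list_length.comp (PrimrecRel.filter (primrec_words.comp Primrec.snd)
      (PrimrecRel.exists_range (Primrec.succ.comp (Primrec.list_length.comp Primrec.snd)) ?_)))
    ) (primrec_two_pow.comp Primrec.snd)
  exact (primrec_testStage c).comp (Primrec.pair (Primrec.fst.comp Primrec.fst)
    (Primrec.list_take.comp Primrec.snd (Primrec.snd.comp Primrec.fst)))

lemma rePred_universalSet : REPred fun v => v ∈ universalSet c := by
  have : PrimrecRel fun (v : List Bool) (n : ℕ) =>
      testSmall c n.unpair.1 n.unpair.2 ∧ v ∈ testStage c n.unpair.1 n.unpair.2 := by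
    refine PrimrecPred.and ?_ ?_
    · exact (primrec_testSmall c).comp (Primrec.fst.comp (Primrec.unpair.comp Primrec.snd))
        (Primrec.snd.comp (Primrec.unpair.comp Primrec.snd))
    · exact (primrec_testStage c).comp (Primrec.pair (Primrec.unpair.comp Primrec.snd) Primrec.fst)
  refine (rePred_exists this).of_eq fun v => ?_
  constructor
  · rintro ⟨n, hn⟩
    exact ⟨_, _, hn⟩
  · rintro ⟨e, t, h⟩
    exact ⟨Nat.pair e t, by simpa using h⟩

lemma coinMeasure_universalSet_le :
    coinMeasure (openSet (universalSet c)) ≤ (2⁻¹ : ℝ≥0∞) ^ c := by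
  have hU : openSet (universalSet c) ⊆
      ⋃ e, ⋃ t : {t // testSmall c e t}, openSet (testStage c e t) := by
    intro β hβ
    obtain ⟨v, ⟨e, t, ht, hv⟩, hβ⟩ := mem_openSet.1 hβ
    simp only [Set.mem_iUnion]
    exact ⟨e, ⟨t, ht⟩, mem_openSet.2 ⟨v, hv, hβ⟩⟩
  calc coinMeasure (openSet (universalSet c))
      ≤ ∑' e, coinMeasure (⋃ t : {t // testSmall c e t}, openSet (testStage c e t)) :=
        (measure_mono hU).trans (measure_iUnion_le _)
    _ ≤ ∑' e : ℕ, (2⁻¹ : ℝ≥0∞) ^ (e + c + 1) := by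
        refine ENNReal.tsum_le_tsum fun e => ?_
        -- The stages increase, so the union of the small ones has the supremum of their measures.
        rw [Directed.measure_iUnion]
        · exact iSup_le fun t => (testSmall_iff c e t).1 t.2
        · apply Monotone.directed_le
          intro s t hst
          exact openSet_mono (testStage_mono c e hst)
    _ = (2⁻¹ : ℝ≥0∞) ^ c := by
        have : ∀ e : ℕ, (2⁻¹ : ℝ≥0∞) ^ (e + c + 1) = 2⁻¹ ^ (c + 1) * 2⁻¹ ^ e := fun e => by
          rw [← pow_add]; congr 1; omega
        simp_rw [this]
        rw [ENNReal.tsum_mul_left, ENNReal.tsum_geometric, ENNReal.one_sub_inv_two, inv_inv,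
          pow_succ, mul_assoc, ENNReal.inv_mul_cancel (by simp) (by simp), mul_one]

lemma isMartinLofRandom_of_notMem {β : ℕ → Bool} (hβ : β ∉ openSet (universalSet c)) :
    IsMartinLofRandom β := by
  rintro W ⟨hre, hW⟩
  obtain ⟨d, hd⟩ := exists_code_eval hre
  set e := encode d with he
  -- A genuine test is small at every stage and never cut off, so its component picked by its own
  -- index lies inside the universal set.
  refine ⟨e + c + 1, fun hmem => hβ ?_⟩
  obtain ⟨v, hv, hβv⟩ := mem_openSet.1 hmem
  have hstage : ∀ t u, u ∈ testStage c e t → u ∈ W (e + c + 1) := by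
    rintro t u ⟨-, hu⟩
    have := dom_eval_iff.2 ⟨t, hu⟩
    rw [he, Denumerable.ofNat_encode, hd] at this
    simpa [Part.assert] using this
  have hdom : (d.eval (encode (e + c + 1, v))).Dom := by
    rw [hd]; simpa [Part.assert] using hv
  obtain ⟨n, hn⟩ := dom_eval_iff.1 hdom
  refine mem_openSet.2 ⟨v, ⟨e, max n v.length, ?_, ?_, ?_⟩, hβv⟩
  · rw [testSmall_iff]
    exact (measure_mono (openSet_mono (hstage _))).trans (hW _)
  · exact Nat.lt_succ_of_le (le_max_right _ _)
  · rw [he, Denumerable.ofNat_encode]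
    exact isSome_evaln_mono (le_max_left _ _) hn

end Universal

/-! ### The machine that follows an enumeration of labelled strings -/

lemma primrec_instr_compute : Primrec Instr.compute :=
  Primrec.of_eq ((Primrec.of_equiv_symm (e := Instr.equivSum)).comp Primrec.sumInl)
    fun _ => rfl

lemma primrec_instr_read : Primrec₂ Instr.read :=
  Primrec.of_eq ((Primrec.of_equiv_symm (e := Instr.equivSum)).comp
    (Primrec.sumInr.comp Primrec.sumInl)) fun _ => rfl

lemma primrec_instr_write : Primrec₂ Instr.write :=
  Primrec.of_eq ((Primrec.of_equiv_symm (e := Instr.equivSum)).comp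
    (Primrec.sumInr.comp Primrec.sumInr)) fun _ => rfl

section Follower

variable (r : ℕ → List Bool → List Bool → Prop)

/-- The candidate examined at time `t`: a stage, an output bit and a string. -/
def candidate (t : ℕ) : ℕ × Bool × List Bool := (decode t).getD (0, false, [])

open Classical in
/-- The instruction for a state that comprises the oracle bits read so far, the output written so
far and a timer. -/
def followerInstr (p : (List Bool × List Bool) × ℕ) : Instr :=
  if r (candidate p.2).1 (p.1.2 ++ [(candidate p.2).2.1]) (candidate p.2).2.2 then
    if (candidate p.2).2.2 <+: p.1.1 then
      .write (candidate p.2).2.1 (encode ((p.1.1, p.1.2 ++ [(candidate p.2).2.1]), 0))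
    else if p.1.1 <+: (candidate p.2).2.2 then
      .read (encode ((p.1.1 ++ [false], p.1.2), 0)) (encode ((p.1.1 ++ [true], p.1.2), 0))
    else .compute (encode (p.1, p.2 + 1))
  else .compute (encode (p.1, p.2 + 1))

lemma primrec_followerInstr
    (hr : PrimrecPred fun p : ℕ × List Bool × List Bool => r p.1 p.2.1 p.2.2) :
    Primrec (followerInstr r) := by
  classical
  have hc : Primrec candidate := Primrec.option_getD.comp Primrec.decode (Primrec.const _)
  have hc' : Primrec fun p : (List Bool × List Bool) × ℕ => candidate p.2 :=
    hc.comp Primrec.snd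
  have hb := Primrec.fst.comp (Primrec.snd.comp hc')
  have hv := Primrec.snd.comp (Primrec.snd.comp hc')
  have hread : Primrec fun p : (List Bool × List Bool) × ℕ => p.1.1 :=
    Primrec.fst.comp Primrec.fst
  have hout : Primrec fun p : (List Bool × List Bool) × ℕ => p.1.2 :=
    Primrec.snd.comp Primrec.fst
  have hout' : Primrec fun p : (List Bool × List Bool) × ℕ => p.1.2 ++ [(candidate p.2).2.1] :=
    Primrec.list_append.comp hout (Primrec.list_cons.comp hb (Primrec.const []))
  have hcomp : Primrec fun p : (List Bool × List Bool) × ℕ =>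
      Instr.compute (encode (p.1, p.2 + 1)) :=
    primrec_instr_compute.comp (Primrec.encode.comp
      (Primrec.pair Primrec.fst (Primrec.succ.comp Primrec.snd)))
  have hbit : ∀ b : Bool, Primrec fun p : (List Bool × List Bool) × ℕ =>
      encode ((p.1.1 ++ [b], p.1.2), 0) := fun b =>
    Primrec.encode.comp (Primrec.pair (Primrec.pair
      (Primrec.list_append.comp hread (Primrec.const [b])) hout) (Primrec.const 0))
  exact Primrec.ite (hr.comp (Primrec.pair (Primrec.fst.comp hc') (Primrec.pair hout' hv)))
    (Primrec.ite (primrecRel_prefix.comp hv hread)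
      (primrec_instr_write.comp hb
        (Primrec.encode.comp (Primrec.pair (Primrec.pair hread hout') (Primrec.const 0))))
      (Primrec.ite (primrecRel_prefix.comp hread hv)
        (primrec_instr_read.comp (hbit false) (hbit true)) hcomp)) hcomp

/-- The machine that writes the next bit `b` as soon as it sees that the oracle extends a string
labelled by the extended output, and reads on when such a string properly extends the part of the
oracle that has been read. -/
def follower (hr : PrimrecPred fun p : ℕ × List Bool × List Bool => r p.1 p.2.1 p.2.2) :
    OracleMachine where
  start := encode ((([], []), 0) : (List Bool × List Bool) × ℕ)
  instr n := followerInstr r ((decode n).getD (([], []), 0))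
  computable_instr := ((primrec_followerInstr r hr).comp
    (Primrec.option_getD.comp Primrec.decode (Primrec.const _))).to_comp

/-! ### Runs of the follower along a chain of labelled strings -/

/-- The configuration of the follower with oracle `β` that has read `m` bits and written
`α ↾ k`. -/
def followerConfig (α β : ℕ → Bool) (k m t : ℕ) : Config :=
  ⟨encode ((initSeg β m, initSeg α k), t), m, initSeg α k⟩

variable {r} (hr : PrimrecPred fun p : ℕ × List Bool × List Bool => r p.1 p.2.1 p.2.2)
  (hpf : ∀ s s' y b b' v v', r s (y ++ [b]) v → r s' (y ++ [b']) v' → v <+: v' → b = b' ∧ v = v')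
  {α β : ℕ → Bool} {T : ℕ → List Bool}
  (hT : ∀ k, ∃ s, r s (initSeg α (k + 1)) (T k)) (hβ : ∀ k, β ∈ cyl (T k))
  (hmono : ∀ k, (T k).length ≤ (T (k + 1)).length)

include hpf hT hβ in
-- The cases are a write, a read and a tick of the timer. A write is correct because labelled
-- strings met by the same oracle are comparable; a tick excludes that the candidate was the right
-- one, which yields progress.
lemma step_followerConfig (k m t : ℕ) :
    (follower r hr).step β (followerConfig α β k m t) = followerConfig α β (k + 1) m 0 ∨
    (m < (T k).length ∧
      (follower r hr).step β (followerConfig α β k m t) = followerConfig α β k (m + 1) 0) ∨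
    ((follower r hr).step β (followerConfig α β k m t) = followerConfig α β k m (t + 1) ∧
      ∀ s, r s (initSeg α (k + 1)) (T k) → candidate t ≠ (s, α k, T k)) := by
  obtain ⟨s₀, hs₀⟩ := hT k
  rw [initSeg_succ] at hs₀
  have hcmp : ∀ v : List Bool, β ∈ cyl v → v <+: T k ∨ T k <+: v := fun v hv =>
    (le_total v.length (T k).length).imp (prefix_of_mem_cyl hv (hβ k))
      (prefix_of_mem_cyl (hβ k) hv)
  have hi : (follower r hr).instr (followerConfig α β k m t).state =
      followerInstr r ((initSeg β m, initSeg α k), t) := by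
    simp [follower, followerConfig]
  rw [OracleMachine.step, hi]
  unfold followerInstr
  rcases hcand : candidate t with ⟨s, b, v⟩
  simp only
  by_cases h₁ : r s (initSeg α k ++ [b]) v
  · rw [if_pos h₁]
    by_cases h₂ : v <+: initSeg β m
    · left
      rw [if_pos h₂]
      have hb : b = α k := by
        rcases hcmp v (prefix_initSeg_iff.1 h₂).2 with h | h
        · exact (hpf _ _ _ _ _ _ _ h₁ hs₀ h).1
        · exact (hpf _ _ _ _ _ _ _ hs₀ h₁ h).1.symm
      subst hb
      simp [followerConfig, initSeg_succ]
    · rw [if_neg h₂]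
      by_cases h₃ : initSeg β m <+: v
      · right; left
        rw [if_pos h₃]
        constructor
        -- If all of `T k` had been read, it would be a prefix of `v`, hence equal to `v`, and the
        -- machine would write instead of reading.
        · by_contra hlt
          have hTm : T k <+: initSeg β m := prefix_initSeg_iff.2 ⟨not_lt.1 hlt, hβ k⟩
          exact h₂ ((hpf _ _ _ _ _ _ _ hs₀ h₁ (hTm.trans h₃)).2 ▸ hTm)
        · cases hm : β m <;> simp [followerConfig, initSeg_succ, hm]
      · right; right
        rw [if_neg h₃]
        refine ⟨rfl, fun s' _ heq => ?_⟩
        obtain ⟨rfl, rfl, rfl⟩ : s = s' ∧ b = α k ∧ v = T k := by simpa using heq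
        rcases le_total (T k).length m with h | h
        · exact h₂ (prefix_initSeg_iff.2 ⟨h, hβ k⟩)
        · exact h₃ (prefix_of_mem_cyl (mem_cyl_initSeg β m) (hβ k) (by simpa using h))
  · right; right
    rw [if_neg h₁]
    refine ⟨rfl, fun s' hs' heq => ?_⟩
    obtain ⟨rfl, rfl, rfl⟩ : s = s' ∧ b = α k ∧ v = T k := by simpa using heq
    rw [initSeg_succ] at hs'
    exact h₁ hs'

lemma run_succ (M : OracleMachine) (β : ℕ → Bool) (t : ℕ) :
    M.run β (t + 1) = M.step β (M.run β t) :=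
  Function.iterate_succ_apply' _ _ _

include hpf hT hβ hmono in
lemma run_follower_eq (t : ℕ) : ∃ k m u, m ≤ (T k).length ∧
    (follower r hr).run β t = followerConfig α β k m u := by
  induction t with
  | zero => exact ⟨0, 0, 0, Nat.zero_le _, by simp [OracleMachine.run, followerConfig, follower,
      initSeg]⟩
  | succ t ih =>
    obtain ⟨k, m, u, hm, h⟩ := ih
    rw [run_succ, h]
    rcases step_followerConfig hr hpf hT hβ k m u with h | ⟨h', h⟩ | ⟨h, -⟩
    · exact ⟨_, _, _, hm.trans (hmono k), h⟩
    · exact ⟨_, _, _, h', h⟩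
    · exact ⟨_, _, _, hm, h⟩

include hpf hT hβ hmono in
-- Two nested inductions: `d` counts the unread bits of `T k`, `e` the ticks left until the code of
-- a right candidate. A read resets the timer but lowers `d`.
lemma exists_run_follower_eq_succ {k d e m t u : ℕ} (hd : (T k).length - m = d)
    (hu : ∃ s, r s (initSeg α (k + 1)) (T k) ∧ encode (s, α k, T k) = u + e)
    (ht : (follower r hr).run β t = followerConfig α β k m u) (hm : m ≤ (T k).length) :
    ∃ t' m', m' ≤ (T (k + 1)).length ∧
      (follower r hr).run β t' = followerConfig α β (k + 1) m' 0 := by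
  induction d using Nat.strong_induction_on generalizing e m t u with
  | _ d ihd =>
  induction e generalizing m t u with
  | zero =>
    obtain ⟨s, hs, he⟩ := hu
    have hcand : candidate u = (s, α k, T k) := by
      rw [candidate, ← Nat.add_zero u, ← he]; simp
    rcases step_followerConfig hr hpf hT hβ k m u with h | ⟨h', h⟩ | ⟨-, h⟩
    · exact ⟨t + 1, m, hm.trans (hmono k), by rw [run_succ, ht, h]⟩
    · exact ihd _ (by omega) rfl ⟨s, hs, (Nat.zero_add _).symm⟩
        (by rw [run_succ, ht, h]) h'
    · exact absurd hcand (h s hs)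
  | succ e ihe =>
    obtain ⟨s, hs, he⟩ := hu
    rcases step_followerConfig hr hpf hT hβ k m u with h | ⟨h', h⟩ | ⟨h, -⟩
    · exact ⟨t + 1, m, hm.trans (hmono k), by rw [run_succ, ht, h]⟩
    · exact ihd _ (by omega) rfl ⟨s, hs, (Nat.zero_add _).symm⟩
        (by rw [run_succ, ht, h]) h'
    · exact ihe (u := u + 1) hd ⟨s, hs, by omega⟩ (by rw [run_succ, ht, h]) hm

include hpf hT hβ hmono in
lemma exists_run_follower_eq (n : ℕ) : ∃ t m, m ≤ (T n).length ∧
    (follower r hr).run β t = followerConfig α β n m 0 := by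
  induction n with
  | zero => exact ⟨0, 0, Nat.zero_le _, by
      simp [OracleMachine.run, followerConfig, follower, initSeg]⟩
  | succ n ih =>
    obtain ⟨t, m, hm, h⟩ := ih
    obtain ⟨s, hs⟩ := hT n
    exact exists_run_follower_eq_succ hr hpf hT hβ hmono rfl
      ⟨s, hs, (Nat.zero_add _).symm⟩ h hm

include hpf hT hβ hmono in
lemma exists_le_length_run_follower (n : ℕ) :
    ∃ t, n ≤ ((follower r hr).run β t).output.length := by
  obtain ⟨t, m, -, h⟩ := exists_run_follower_eq hr hpf hT hβ hmono n
  exact ⟨t, by simp [h, followerConfig]⟩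

include hpf hT hβ hmono in
theorem follower_computes : (follower r hr).Computes β α := by
  refine ⟨fun t => ?_, exists_le_length_run_follower hr hpf hT hβ hmono⟩
  obtain ⟨k, m, u, -, h⟩ := run_follower_eq hr hpf hT hβ hmono t
  simp [h, followerConfig]

include hpf hT hβ hmono in
theorem follower_oracleUse_succ (n : ℕ) :
    ∃ u ∈ (follower r hr).oracleUse β (n + 1), u ≤ (T n).length := by
  classical
  have hd := exists_le_length_run_follower hr hpf hT hβ hmono (n + 1)
  refine ⟨_, ⟨hd, rfl⟩, ?_⟩
  show ((follower r hr).run β (Nat.find hd)).bitsRead ≤ _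
  have hspec := Nat.find_spec hd
  have hmin : ∀ t < Nat.find hd, _ := fun t ht => Nat.find_min hd ht
  generalize Nat.find hd = t at hspec hmin
  cases t with
  | zero => simp [OracleMachine.run] at hspec
  | succ t =>
    -- The last step before the first moment must be the write that completes `n + 1` bits, and it
    -- reads nothing.
    have hlt := hmin t (Nat.lt_succ_self t)
    obtain ⟨k, m, u, hm, h⟩ := run_follower_eq hr hpf hT hβ hmono t
    rw [run_succ, h] at hspec ⊢
    rw [h] at hlt
    have hk : k ≤ n := by simpa [followerConfig] using hlt
    rcases step_followerConfig hr hpf hT hβ k m u with h | ⟨h', h⟩ | ⟨h, -⟩ <;> rw [h] at hspec ⊢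
    · have : n ≤ k := by simpa [followerConfig] using hspec
      obtain rfl : k = n := le_antisymm hk this
      exact hm
    all_goals
      have : n + 1 ≤ k := by simpa [followerConfig] using hspec
      omega

lemma zero_mem_oracleUse_zero (M : OracleMachine) (β : ℕ → Bool) : 0 ∈ M.oracleUse β 0 := by
  classical
  have hd : ∃ t, 0 ≤ (M.run β t).output.length := ⟨0, Nat.zero_le _⟩
  refine ⟨hd, ?_⟩
  have h0 : Nat.find hd = 0 := (Nat.find_eq_zero hd).2 (Nat.zero_le _)
  show (M.run β (Nat.find hd)).bitsRead = 0
  rw [h0]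
  rfl

end Follower

/-! ### The allocation of strings -/

section Allocation

/-- A cell is a string together with its owner. -/
abbrev Cell := List Bool × List Bool

variable (k : ℕ → List Bool → Option ℕ) (u : ℕ → List Bool → Prop)

/-- All extensions of `v` by `t` bits have a prefix enumerated by the stage `t`. -/
def Dead (t : ℕ) (v : List Bool) : Prop :=
  ∀ w ∈ words t, ∃ i < (v ++ w).length + 1, u t ((v ++ w).take i)

/-- The string served at the stage `t`. -/
def target (t : ℕ) : List Bool := (decode t.unpair.2).getD []

/-- The length known at the stage `t` for the prefix of length `i` of `x`. -/
def lengthAt (t : ℕ) (x : List Bool) (i : ℕ) : ℕ := (k t (x.take i)).getD 0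

open Classical in
/-- The cells that are not dead. -/
def prune (t : ℕ) (s : List Cell) : List Cell := s.filter fun c => decide (¬ Dead u t c.1)

/-- The string `x` and all its prefixes have a length, but `x` owns no cell. -/
def Ready (t : ℕ) (x : List Bool) (s : List Cell) : Prop :=
  (∀ i < x.length + 1, (k t (x.take i)).isSome) ∧ ∀ c ∈ s, c.2 ≠ x

/-- The cell can be split in favour of `x`: the owner is a proper prefix of `x`, and the cell is
large enough for all longer prefixes of `x`. -/
def Eligible (t : ℕ) (x : List Bool) (c : Cell) : Prop :=
  c.2 <+: x ∧ c.2.length < x.length ∧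
    ∀ i < x.length + 1, c.2.length < i → c.1.length ≤ lengthAt k t x i

/-- Longer owners come first, and smaller cells come first among the cells of the same owner. -/
def RankLE (b a : Cell) : Prop :=
  b.2.length < a.2.length ∨ b.2.length = a.2.length ∧ b.1.length ≤ a.1.length

open Classical in
/-- The best cell to be split in favour of `x`. -/
def chosen (t : ℕ) (x : List Bool) (s : List Cell) : Option Cell :=
  ((s.filter fun c => decide (Eligible k t x c)).filter fun a =>
    decide (∀ b ∈ s.filter fun c => decide (Eligible k t x c), RankLE b a)).head?

open Classical in
/-- The owner of the `j`-th remainder when the cell `c` is split in favour of `x`. -/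
def remainderOwner (t : ℕ) (x : List Bool) (c : Cell) (j : ℕ) : List Bool :=
  -- The first alternative keeps the old owner as a fallback. In the second, `c.1.length + j` is one
  -- less than the length of the remainder, so a new owner gets a cell strictly longer than its K.
  x.take (Nat.findGreatest (fun i => i ≤ c.2.length ∨ lengthAt k t x i ≤ c.1.length + j) x.length)

/-- The number of bits by which the cell `c` has to be extended for `x`. -/
def excess (t : ℕ) (x : List Bool) (c : Cell) : ℕ := lengthAt k t x x.length - c.1.length

/-- The cells into which the cell `c` is split in favour of `x`. -/
def splitCell (t : ℕ) (x : List Bool) (c : Cell) : List Cell :=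
  (c.1 ++ List.replicate (excess k t x c) false, x) ::
    (List.range (excess k t x c)).map fun j =>
      (c.1 ++ List.replicate j false ++ [true], remainderOwner k t x c j)

open Classical in
/-- The cell that is split at the stage `t`. -/
def event (t : ℕ) (s : List Cell) : Option Cell :=
  if Ready k t (target t) (prune u t s) then chosen k t (target t) (prune u t s) else none

open Classical in
/-- One stage of the allocation. -/
def allocStep (t : ℕ) (s : List Cell) : List Cell :=
  (event k u t s).elim (prune u t s) fun c =>
    (prune u t s).filter (fun a => decide (a ≠ c)) ++ splitCell k t (target t) c

/-- The list of cells before the stage `t`. -/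
def alloc (t : ℕ) : List Cell := Nat.rec [([], [])] (fun t s => allocStep k u t s) t

/-- The string `v` is assigned to `y` at the stage `t`. -/
def Chunk (t : ℕ) (y v : List Bool) : Prop :=
  ∃ c ∈ event k u t (alloc k u t), c.2.length < y.length ∧ y <+: target t ∧
    v <+: c.1 ++ List.replicate (excess k t (target t) c) false ∧
    -- This line and the next say that the length of `v` is the minimum of K over the prefixes of
    -- the target that extend `y`.
    (∀ i < (target t).length + 1, y.length ≤ i → v.length ≤ lengthAt k t (target t) i) ∧
    ∃ i < (target t).length + 1, y.length ≤ i ∧ lengthAt k t (target t) i = v.length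

/-! ### The allocation is computable -/

section Computability

variable {α : Type*} [Primcodable α] {k u}

lemma primrec_dead (hu : PrimrecRel u) : PrimrecRel (Dead u) := by
  have h : Primrec fun p : (ℕ × List Bool) × List Bool => p.1.2 ++ p.2 :=
    Primrec.list_append.comp (Primrec.snd.comp Primrec.fst) Primrec.snd
  exact PrimrecRel.forall_mem (primrec_words.comp Primrec.fst)
    (PrimrecRel.exists_range (Primrec.succ.comp (Primrec.list_length.comp h))
      (hu.comp (Primrec.fst.comp (Primrec.fst.comp Primrec.fst))
        (Primrec.list_take.comp Primrec.snd (h.comp Primrec.fst))))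

lemma primrec_target : Primrec target :=
  Primrec.option_getD.comp (Primrec.decode.comp (Primrec.snd.comp Primrec.unpair))
    (Primrec.const [])

lemma primrec_lengthAt (hk : Primrec₂ k) {t i : α → ℕ} {x : α → List Bool} (ht : Primrec t)
    (hx : Primrec x) (hi : Primrec i) : Primrec fun a => lengthAt k (t a) (x a) (i a) :=
  Primrec.option_getD.comp (hk.comp ht (Primrec.list_take.comp hi hx)) (Primrec.const 0)

open Classical in
lemma primrec_prune (hu : PrimrecRel u) : Primrec₂ (prune u) :=
  PrimrecRel.filter Primrec.snd
    ((primrec_dead hu).comp (Primrec.fst.comp Primrec.fst) (Primrec.fst.comp Primrec.snd)).not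

lemma primrec_ready (hk : Primrec₂ k) {t : α → ℕ} {x : α → List Bool} {s : α → List Cell}
    (ht : Primrec t) (hx : Primrec x) (hs : Primrec s) :
    PrimrecPred fun a => Ready k (t a) (x a) (s a) := by
  refine PrimrecPred.and ?_ ?_
  · exact PrimrecRel.forall_range (Primrec.succ.comp (Primrec.list_length.comp hx))
      (Primrec.eq.comp (Primrec.option_isSome.comp (hk.comp (ht.comp Primrec.fst)
        (Primrec.list_take.comp Primrec.snd (hx.comp Primrec.fst)))) (Primrec.const true))
  · exact PrimrecRel.forall_mem hs
      (Primrec.eq.comp (Primrec.snd.comp Primrec.snd) (hx.comp Primrec.fst)).not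

lemma _root_.PrimrecPred.imp {p q : α → Prop} (hp : PrimrecPred p) (hq : PrimrecPred q) :
    PrimrecPred fun a => p a → q a := by
  classical
  exact (hp.not.or hq).of_eq fun a => by tauto

lemma primrec_eligible (hk : Primrec₂ k) {t : α → ℕ} {x : α → List Bool} {c : α → Cell}
    (ht : Primrec t) (hx : Primrec x) (hc : Primrec c) :
    PrimrecPred fun a => Eligible k (t a) (x a) (c a) := by
  have h1 := Primrec.fst.comp hc
  have h2 := Primrec.snd.comp hc
  refine PrimrecPred.and (primrecRel_prefix.comp h2 hx) (PrimrecPred.and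
    (Primrec.nat_lt.comp (Primrec.list_length.comp h2) (Primrec.list_length.comp hx)) ?_)
  exact PrimrecRel.forall_range (Primrec.succ.comp (Primrec.list_length.comp hx))
    (PrimrecPred.imp
      (Primrec.nat_lt.comp (Primrec.list_length.comp (h2.comp Primrec.fst)) Primrec.snd)
      (Primrec.nat_le.comp (Primrec.list_length.comp (h1.comp Primrec.fst))
        (primrec_lengthAt hk (ht.comp Primrec.fst) (hx.comp Primrec.fst) Primrec.snd)))

lemma primrec_rankLE : PrimrecRel RankLE := by
  have h1 : Primrec fun p : Cell × Cell => p.1.2.length :=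
    Primrec.list_length.comp (Primrec.snd.comp Primrec.fst)
  have h2 : Primrec fun p : Cell × Cell => p.2.2.length :=
    Primrec.list_length.comp (Primrec.snd.comp Primrec.snd)
  exact PrimrecPred.or (Primrec.nat_lt.comp h1 h2) (PrimrecPred.and (Primrec.eq.comp h1 h2)
    (Primrec.nat_le.comp (Primrec.list_length.comp (Primrec.fst.comp Primrec.fst))
      (Primrec.list_length.comp (Primrec.fst.comp Primrec.snd))))

open Classical in
lemma primrec_chosen (hk : Primrec₂ k) {t : α → ℕ} {x : α → List Bool} {s : α → List Cell}
    (ht : Primrec t) (hx : Primrec x) (hs : Primrec s) :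
    Primrec fun a => chosen k (t a) (x a) (s a) := by
  have he : Primrec fun a => (s a).filter fun c => decide (Eligible k (t a) (x a) c) :=
    PrimrecRel.filter hs (primrec_eligible hk (ht.comp Primrec.fst) (hx.comp Primrec.fst)
      Primrec.snd)
  exact Primrec.list_head?.comp (PrimrecRel.filter he (PrimrecRel.forall_mem (he.comp Primrec.fst)
    (primrec_rankLE.comp Primrec.snd (Primrec.snd.comp Primrec.fst))))

open Classical in
lemma primrec_remainderOwner (hk : Primrec₂ k) {t j : α → ℕ} {x : α → List Bool} {c : α → Cell}
    (ht : Primrec t) (hx : Primrec x) (hc : Primrec c) (hj : Primrec j) :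
    Primrec fun a => remainderOwner k (t a) (x a) (c a) (j a) := by
  refine Primrec.list_take.comp (Primrec.nat_findGreatest (Primrec.list_length.comp hx)
    (PrimrecPred.or (Primrec.nat_le.comp Primrec.snd
      (Primrec.list_length.comp (Primrec.snd.comp (hc.comp Primrec.fst))))
      (Primrec.nat_le.comp
        (primrec_lengthAt hk (ht.comp Primrec.fst) (hx.comp Primrec.fst) Primrec.snd)
        (Primrec.nat_add.comp (Primrec.list_length.comp (Primrec.fst.comp (hc.comp Primrec.fst)))
          (hj.comp Primrec.fst))))) hx

lemma primrec_excess (hk : Primrec₂ k) {t : α → ℕ} {x : α → List Bool} {c : α → Cell}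
    (ht : Primrec t) (hx : Primrec x) (hc : Primrec c) :
    Primrec fun a => excess k (t a) (x a) (c a) :=
  Primrec.nat_sub.comp (primrec_lengthAt hk ht hx (Primrec.list_length.comp hx))
    (Primrec.list_length.comp (Primrec.fst.comp hc))

lemma primrec_splitCell (hk : Primrec₂ k) {t : α → ℕ} {x : α → List Bool} {c : α → Cell}
    (ht : Primrec t) (hx : Primrec x) (hc : Primrec c) :
    Primrec fun a => splitCell k (t a) (x a) (c a) := by
  have he := primrec_excess hk ht hx hc
  refine Primrec.list_cons.comp (Primrec.pair (Primrec.list_append.comp (Primrec.fst.comp hc)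
    (primrec_replicate.comp he)) hx) (Primrec.list_map (Primrec.list_range.comp he) ?_)
  exact Primrec.pair (Primrec.list_append.comp (Primrec.list_append.comp
    (Primrec.fst.comp (hc.comp Primrec.fst)) (primrec_replicate.comp Primrec.snd))
      (Primrec.const [true]))
    (primrec_remainderOwner hk (ht.comp Primrec.fst) (hx.comp Primrec.fst) (hc.comp Primrec.fst)
      Primrec.snd)

lemma primrec_event (hk : Primrec₂ k) (hu : PrimrecRel u) : Primrec₂ (event k u) := by
  classical
  have ht := primrec_target.comp (Primrec.fst (α := ℕ) (β := List Cell))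
  exact Primrec.ite (primrec_ready hk Primrec.fst ht (primrec_prune hu))
    (primrec_chosen hk Primrec.fst ht (primrec_prune hu)) (Primrec.const none)

lemma primrec_allocStep (hk : Primrec₂ k) (hu : PrimrecRel u) : Primrec₂ (allocStep k u) := by
  classical
  have h : Primrec₂ fun (p : ℕ × List Cell) (c : Cell) =>
      (prune u p.1 p.2).filter (fun a => decide (a ≠ c)) ++ splitCell k p.1 (target p.1) c := by
    refine Primrec.list_append.comp (PrimrecRel.filter
      ((primrec_prune hu).comp (Primrec.fst.comp Primrec.fst) (Primrec.snd.comp Primrec.fst))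
      (Primrec.eq.comp Primrec.snd (Primrec.snd.comp Primrec.fst)).not) ?_
    exact primrec_splitCell hk (Primrec.fst.comp Primrec.fst)
      (primrec_target.comp (Primrec.fst.comp Primrec.fst)) Primrec.snd
  refine (Primrec.option_casesOn (primrec_event hk hu) (primrec_prune hu) h).of_eq ?_
  rintro ⟨t, s⟩
  rw [allocStep]
  cases h : event k u t s <;> simp

lemma primrec_alloc (hk : Primrec₂ k) (hu : PrimrecRel u) : Primrec (alloc k u) :=
  Primrec.nat_rec₁ _ (primrec_allocStep hk hu)

lemma primrec_chunk (hk : Primrec₂ k) (hu : PrimrecRel u) :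
    PrimrecPred fun p : ℕ × List Bool × List Bool => Chunk k u p.1 p.2.1 p.2.2 := by
  have hev : Primrec fun p : ℕ × List Bool × List Bool =>
      (event k u p.1 (alloc k u p.1)).toList :=
    Primrec.optionToList.comp ((primrec_event hk hu).comp Primrec.fst
      ((primrec_alloc hk hu).comp Primrec.fst))
  have ht : Primrec fun p : (ℕ × List Bool × List Bool) × Cell => p.1.1 :=
    Primrec.fst.comp Primrec.fst
  have hx := primrec_target.comp ht
  have hxl := Primrec.succ.comp (Primrec.list_length.comp hx)
  have hy : Primrec fun p : (ℕ × List Bool × List Bool) × Cell => p.1.2.1 :=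
    Primrec.fst.comp (Primrec.snd.comp Primrec.fst)
  have hv : Primrec fun p : (ℕ × List Bool × List Bool) × Cell => p.1.2.2 :=
    Primrec.snd.comp (Primrec.snd.comp Primrec.fst)
  have hc : Primrec fun p : (ℕ × List Bool × List Bool) × Cell => p.2 := Primrec.snd
  have hlen := primrec_lengthAt hk (ht.comp Primrec.fst) (hx.comp Primrec.fst)
    (Primrec.snd (β := ℕ))
  have hyi := Primrec.nat_le.comp (Primrec.list_length.comp (hy.comp Primrec.fst))
    (Primrec.snd (β := ℕ))
  have hvl := Primrec.list_length.comp (hv.comp (Primrec.fst (β := ℕ)))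
  have hall : PrimrecPred fun p : (ℕ × List Bool × List Bool) × Cell =>
      ∀ i < (target p.1.1).length + 1, p.1.2.1.length ≤ i →
        p.1.2.2.length ≤ lengthAt k p.1.1 (target p.1.1) i :=
    PrimrecRel.forall_range hxl (PrimrecPred.imp hyi (Primrec.nat_le.comp hvl hlen))
  have hex : PrimrecPred fun p : (ℕ × List Bool × List Bool) × Cell =>
      ∃ i < (target p.1.1).length + 1, p.1.2.1.length ≤ i ∧
        lengthAt k p.1.1 (target p.1.1) i = p.1.2.2.length :=
    PrimrecRel.exists_range hxl (PrimrecPred.and hyi (Primrec.eq.comp hlen hvl))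
  have hbody : PrimrecRel fun (p : ℕ × List Bool × List Bool) (c : Cell) =>
      c.2.length < p.2.1.length ∧ p.2.1 <+: target p.1 ∧
        p.2.2 <+: c.1 ++ List.replicate (excess k p.1 (target p.1) c) false ∧
        (∀ i < (target p.1).length + 1, p.2.1.length ≤ i →
          p.2.2.length ≤ lengthAt k p.1 (target p.1) i) ∧
        ∃ i < (target p.1).length + 1, p.2.1.length ≤ i ∧
          lengthAt k p.1 (target p.1) i = p.2.2.length :=
    PrimrecPred.and (Primrec.nat_lt.comp (Primrec.list_length.comp (Primrec.snd.comp hc))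
      (Primrec.list_length.comp hy)) (PrimrecPred.and (primrecRel_prefix.comp hy hx)
      (PrimrecPred.and (primrecRel_prefix.comp hv (Primrec.list_append.comp
        (Primrec.fst.comp hc) (primrec_replicate.comp (primrec_excess hk ht hx hc))))
      (PrimrecPred.and hall hex)))
  refine (PrimrecRel.exists_mem hev hbody).of_eq fun p => ?_
  simp [Chunk]

end Computability

end Allocation

/-! ### Strings of the form `0 ⋯ 0` and `0 ⋯ 0 1` -/

lemma not_replicate_true_prefix {j e : ℕ} :
    ¬ List.replicate j false ++ [true] <+: List.replicate e false := by
  intro h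
  have := h.subset (by simp : true ∈ List.replicate j false ++ [true])
  simp at this

lemma le_of_replicate_prefix {j e : ℕ}
    (h : List.replicate e false <+: List.replicate j false ++ [true]) : e ≤ j := by
  by_contra hlt
  have hl : e ≤ j + 1 := by simpa using h.length_le
  have he := h.eq_of_length (by simp; omega)
  have : true ∈ List.replicate e false := by rw [he]; simp
  simp at this

lemma eq_of_replicate_true_prefix {j j' : ℕ}
    (h : List.replicate j false ++ [true] <+: List.replicate j' false ++ [true]) : j = j' := by
  have h₁ : j' ≤ j := by
    by_contra hlt
    have hp : List.replicate j' false <+: List.replicate j' false ++ [true] :=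
      List.prefix_append _ _
    exact not_replicate_true_prefix (List.prefix_of_prefix_length_le h hp (by simp; omega))
  have h₂ : j + 1 ≤ j' + 1 := by simpa using h.length_le
  omega

lemma replicate_prefix {i j : ℕ} (h : i ≤ j) :
    List.replicate i false <+: List.replicate j false := by
  obtain ⟨d, rfl⟩ := Nat.exists_eq_add_of_le h
  rw [List.replicate_add]
  exact List.prefix_append _ _

lemma cyl_split {β : ℕ → Bool} {v : List Bool} (h : β ∈ cyl v) (e : ℕ) :
    β ∈ cyl (v ++ List.replicate e false) ∨
      ∃ j < e, β ∈ cyl (v ++ List.replicate j false ++ [true]) := by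
  induction e with
  | zero => left; simpa using h
  | succ e ih =>
    rcases ih with ih | ⟨j, hj, ih⟩
    · rw [mem_cyl] at ih
      have hs : initSeg β (v ++ List.replicate e false ++ [β (v ++ List.replicate e false).length]).length
          = v ++ List.replicate e false ++ [β (v ++ List.replicate e false).length] := by
        rw [List.length_append, List.length_singleton, initSeg_succ, ih]
      cases hb : β (v ++ List.replicate e false).length with
      | false =>
        left
        rw [hb] at hs
        rw [List.replicate_succ', ← List.append_assoc]
        exact hs
      | true =>
        right
        rw [hb] at hs
        exact ⟨e, Nat.lt_succ_self e, hs⟩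
    · exact .inr ⟨j, by omega, ih⟩

/-! ### The effect of one stage -/

section Step

variable {k : ℕ → List Bool → Option ℕ} {u : ℕ → List Bool → Prop}
  {κ : List Bool → ℕ} {D : List Bool → Prop} {U : Set (List Bool)}

/-- The cell `c` of `s` is the best one that can be split in favour of `x`. -/
structure IsBestCell (κ : List Bool → ℕ) (D : List Bool → Prop) (x : List Bool) (s : List Cell)
    (c : Cell) : Prop where
  dom : ∀ i ≤ x.length, D (x.take i)
  not_owner : ∀ a ∈ s, a.2 ≠ x
  mem : c ∈ s
  owner_prefix : c.2 <+: x
  owner_lt : c.2.length < x.length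
  length_le : ∀ i ≤ x.length, c.2.length < i → c.1.length ≤ κ (x.take i)
  best : ∀ b ∈ s, b.2 <+: x → b.2.length < x.length →
    (∀ i ≤ x.length, b.2.length < i → b.1.length ≤ κ (x.take i)) → RankLE b c

/-- The cell `a` is one of those into which the cell `c` is split in favour of `x`. -/
def IsPart (κ : List Bool → ℕ) (x : List Bool) (c a : Cell) : Prop :=
  a = (c.1 ++ List.replicate (κ x - c.1.length) false, x) ∨
    ∃ j < κ x - c.1.length, ∃ m, a = (c.1 ++ List.replicate j false ++ [true], x.take m) ∧
      c.2.length ≤ m ∧ m < x.length ∧ (c.2.length < m → κ (x.take m) ≤ c.1.length + j) ∧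
      ∀ i ≤ x.length, m < i → c.1.length + j < κ (x.take i)

/-- The string `v` is assigned to `y` when the cell `c` is split in favour of `x`. -/
def IsAssigned (κ : List Bool → ℕ) (x : List Bool) (c : Cell) (y v : List Bool) : Prop :=
  c.2.length < y.length ∧ y <+: x ∧ v <+: c.1 ++ List.replicate (κ x - c.1.length) false ∧
    (∀ i ≤ x.length, y.length ≤ i → v.length ≤ κ (x.take i)) ∧
    ∃ i ≤ x.length, y.length ≤ i ∧ κ (x.take i) = v.length

variable (hk : ∀ t x n, k t x = some n → D x ∧ κ x = n)

include hk in
-- `Ready` excludes the default value 0, so stage approximations can be replaced by true lengths.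
lemma lengthAt_eq {t : ℕ} {x : List Bool} {s : List Cell} (h : Ready k t x s) {i : ℕ}
    (hi : i ≤ x.length) : D (x.take i) ∧ lengthAt k t x i = κ (x.take i) := by
  obtain ⟨n, hn⟩ := Option.isSome_iff_exists.1 (h.1 i (by omega))
  have := hk _ _ _ hn
  exact ⟨this.1, by simp [lengthAt, hn, this.2]⟩

lemma chosen_spec {t : ℕ} {x : List Bool} {s : List Cell} {c : Cell} (h : c ∈ chosen k t x s) :
    c ∈ s ∧ Eligible k t x c ∧ ∀ b ∈ s, Eligible k t x b → RankLE b c := by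
  have := List.mem_of_mem_head? h
  simp only [List.mem_filter, decide_eq_true_eq] at this
  exact ⟨this.1.1, this.1.2, fun b hb hb' => this.2 b ⟨hb, hb'⟩⟩

lemma ready_of_mem_event {t : ℕ} {s : List Cell} {c : Cell} (h : c ∈ event k u t s) :
    Ready k t (target t) (prune u t s) := by
  by_contra hn
  simp [event, hn] at h

include hk in
lemma isBestCell_of_mem_event {t : ℕ} {s : List Cell} {c : Cell} (h : c ∈ event k u t s) :
    IsBestCell κ D (target t) (prune u t s) c := by
  have hr := ready_of_mem_event h
  rw [event, if_pos hr] at h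
  obtain ⟨h1, h2, h3⟩ := chosen_spec h
  have hl := fun i (hi : i ≤ (target t).length) => lengthAt_eq hk hr hi
  refine ⟨fun i hi => (hl i hi).1, hr.2, h1, h2.1, h2.2.1, fun i hi hc => ?_,
    fun b hb hb1 hb2 hb3 => h3 b hb ⟨hb1, hb2, fun i hi hc => ?_⟩⟩
  · rw [← (hl i hi).2]
    exact h2.2.2 i (by omega) hc
  · rw [(hl i (by omega)).2]
    exact hb3 i (by omega) hc

include hk in
lemma excess_eq {t : ℕ} {s : List Cell} {c : Cell} (h : c ∈ event k u t s) :
    excess k t (target t) c = κ (target t) - c.1.length := by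
  rw [excess, (lengthAt_eq hk (ready_of_mem_event h) le_rfl).2, List.take_length]

lemma allocStep_of_event_none {t : ℕ} {s : List Cell} (h : event k u t s = none) :
    allocStep k u t s = prune u t s := by simp [allocStep, h]

lemma mem_allocStep {t : ℕ} {s : List Cell} {c : Cell} (h : c ∈ event k u t s) {a : Cell} :
    a ∈ allocStep k u t s ↔
      (a ∈ prune u t s ∧ a ≠ c) ∨ a ∈ splitCell k t (target t) c := by
  rw [Option.mem_def] at h
  simp [allocStep, h]

include hk in
lemma isPart_of_mem_splitCell {t : ℕ} {s : List Cell} {c : Cell} (h : c ∈ event k u t s)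
    {a : Cell} (ha : a ∈ splitCell k t (target t) c) : IsPart κ (target t) c a := by
  classical
  have hb := isBestCell_of_mem_event hk h
  have hr := ready_of_mem_event h
  rw [splitCell, excess_eq hk h, List.mem_cons, List.mem_map] at ha
  refine ha.imp_right ?_
  rintro ⟨j, hj, rfl⟩
  rw [List.mem_range] at hj
  refine ⟨j, hj, _, rfl, ?_⟩
  set P : ℕ → Prop := fun i => i ≤ c.2.length ∨ lengthAt k t (target t) i ≤ c.1.length + j with hP
  set m := Nat.findGreatest P (target t).length with hm
  have hlt := hb.owner_lt
  have h1 : c.2.length ≤ m := Nat.le_findGreatest hlt.le (Or.inl le_rfl)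
  have h2 : P m := Nat.findGreatest_spec (P := P) hlt.le (Or.inl le_rfl)
  have hml : m ≤ (target t).length := Nat.findGreatest_le _
  -- The full length fails the predicate: it exceeds that of the owner, and `j` is below the excess.
  have h3 : m < (target t).length := by
    refine lt_of_le_of_ne hml fun heq => ?_
    rw [heq] at h2
    rcases h2 with h2 | h2
    · omega
    · rw [(lengthAt_eq hk hr le_rfl).2, List.take_length] at h2
      omega
  refine ⟨h1, h3, fun hlt => ?_, fun i hi hmi => ?_⟩
  · rw [← (lengthAt_eq hk hr hml).2]
    rcases h2 with h2 | h2
    · omega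
    · exact h2
  · rw [← (lengthAt_eq hk hr hi).2]
    have := Nat.findGreatest_is_greatest hmi hi
    rw [hP] at this
    push Not at this
    exact this.2

include hk in
lemma chunk_iff {t : ℕ} {y v : List Bool} :
    Chunk k u t y v ↔ ∃ c ∈ event k u t (alloc k u t), IsAssigned κ (target t) c y v := by
  refine exists_congr fun c => and_congr_right fun hc => ?_
  have hl := fun i (hi : i ≤ (target t).length) => (lengthAt_eq hk (ready_of_mem_event hc) hi).2
  rw [excess_eq hk hc]
  refine and_congr_right fun _ => and_congr_right fun _ => and_congr_right fun _ => ?_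
  simp only [Nat.lt_succ_iff]
  refine and_congr (forall₂_congr fun i hi => by rw [hl i hi]) ?_
  refine exists_congr fun i => and_congr_right fun hi => by rw [hl i hi]

lemma mem_of_mem_prune {t : ℕ} {s : List Cell} {a : Cell} (h : a ∈ prune u t s) : a ∈ s :=
  List.mem_of_mem_filter h

lemma IsPart.prefix {x : List Bool} {c a : Cell} (h : IsPart κ x c a) (hc : c.2 <+: x) :
    c.1 <+: a.1 ∧ c.2 <+: a.2 ∧ a.2 <+: x := by
  rcases h with rfl | ⟨j, -, m, rfl, hm, -⟩
  · exact ⟨List.prefix_append _ _, hc, List.prefix_rfl⟩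
  · refine ⟨(List.prefix_append _ _).trans (List.prefix_append _ _), ?_, List.take_prefix _ _⟩
    exact List.prefix_of_prefix_length_le hc (List.take_prefix _ _) (by
      have := hc.length_le
      simp; omega)

lemma IsPart.eq_of_prefix {x : List Bool} {c a b : Cell} (ha : IsPart κ x c a)
    (hb : IsPart κ x c b) (h : a.1 <+: b.1) : a = b := by
  rcases ha with rfl | ⟨j, hj, m, rfl, hm, hm₁, hm₂, hm₃⟩ <;>
    rcases hb with rfl | ⟨j', hj', m', rfl, hm', hm₁', hm₂', hm₃'⟩
  · rfl
  · simp only [List.append_assoc, List.prefix_append_right_inj] at h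
    have := le_of_replicate_prefix h
    omega
  · simp only [List.append_assoc, List.prefix_append_right_inj] at h
    exact absurd h not_replicate_true_prefix
  · simp only [List.append_assoc, List.prefix_append_right_inj] at h
    obtain rfl := eq_of_replicate_true_prefix h
    -- The owner is determined by `j`, since both indices are the greatest admissible one.
    have : m = m' := by
      rcases lt_trichotomy m m' with hlt | heq | hlt
      · have := hm₃ m' hm₁'.le hlt
        have := hm₂' (by omega)
        omega
      · exact heq
      · have := hm₃' m hm₁.le hlt
        have := hm₂ (by omega)
        omega
    rw [this]

/-- A string is assigned to every prefix of `x` that is longer than the owner of the cell. -/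
lemma IsBestCell.exists_isAssigned {x : List Bool} {s : List Cell} {c : Cell}
    (h : IsBestCell κ D x s c) {m : ℕ} (hm : c.2.length < m) (hmx : m ≤ x.length) :
    ∃ v, IsAssigned κ x c (x.take m) v ∧ c.1 <+: v ∧
      v = c.1 ++ List.replicate (v.length - c.1.length) false := by
  -- The minimum becomes the length of the assigned string; eligibility keeps it at or above the
  -- length of the cell.
  obtain ⟨i, hi, hmin⟩ := Finset.exists_min_image (Finset.Icc m x.length)
    (fun i => κ (x.take i)) ⟨m, Finset.mem_Icc.2 ⟨le_rfl, hmx⟩⟩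
  rw [Finset.mem_Icc] at hi
  have hL := h.length_le i hi.2 (by omega)
  have hx := hmin x.length (Finset.mem_Icc.2 ⟨hmx, le_rfl⟩)
  rw [List.take_length] at hx
  have hlen : (c.1 ++ List.replicate (κ (x.take i) - c.1.length) false).length = κ (x.take i) := by
    simp; omega
  refine ⟨c.1 ++ List.replicate (κ (x.take i) - c.1.length) false, ⟨?_, List.take_prefix _ _,
    (List.prefix_append_right_inj _).2 (replicate_prefix (by omega)), fun i' hi' hm' => ?_,
    i, hi.2, ?_, hlen.symm⟩, List.prefix_append _ _, by rw [hlen]⟩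
  · simp; omega
  · rw [hlen]
    exact hmin i' (Finset.mem_Icc.2 ⟨by simp at hm'; omega, hi'⟩)
  · simp; omega

lemma IsAssigned.length_eq {x : List Bool} {c : Cell} {y y' v v' : List Bool}
    (h : IsAssigned κ x c y v) (h' : IsAssigned κ x c y' v') (hy : y.length = y'.length) :
    y = y' ∧ v = v' := by
  obtain ⟨-, hy₁, hv, hle, i, hi, hyi, heq⟩ := h
  obtain ⟨-, hy₁', hv', hle', i', hi', hyi', heq'⟩ := h'
  have h₁ : v.length = v'.length := by
    have := hle i' hi' (by omega)
    have := hle' i hi (by omega)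
    omega
  exact ⟨(List.prefix_of_prefix_length_le hy₁ hy₁' hy.le).eq_of_length hy,
    (List.prefix_of_prefix_length_le hv hv' h₁.le).eq_of_length h₁⟩

lemma IsAssigned.cell_prefix {x : List Bool} {s : List Cell} {c : Cell} {y v : List Bool}
    (h : IsAssigned κ x c y v) (hc : IsBestCell κ D x s c) : c.1 <+: v := by
  obtain ⟨hlt, -, hv, -, i, hi, hyi, heq⟩ := h
  exact List.prefix_of_prefix_length_le (List.prefix_append _ _) hv
    (heq ▸ hc.length_le i hi (by omega))

/-- The remainder with index `j` leaves the zeros after `j` of them, so it is comparable with `v`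
only if `v` ends by then. A prefix of `x` whose K equals the length of `v` is then at most as long
as the new owner, as K exceeds `c.1.length + j` on all longer ones. -/
lemma IsAssigned.prefix_part {x : List Bool} {s : List Cell} {c a : Cell} {y v : List Bool}
    (h : IsAssigned κ x c y v) (hc : IsBestCell κ D x s c) (ha : IsPart κ x c a)
    (hcomp : a.1 <+: v ∨ v <+: a.1) : v <+: a.1 ∧ y <+: a.2 := by
  have hcv := h.cell_prefix hc
  obtain ⟨hlt, hyx, hv, hle, i, hi, hyi, heq⟩ := h
  rcases ha with rfl | ⟨j, hj, m, rfl, hm, hm₁, hm₂, hm₃⟩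
  · exact ⟨hv, hyx⟩
  · obtain ⟨z, rfl⟩ := hcv
    rw [List.prefix_append_right_inj] at hv
    have hz : z = List.replicate z.length false := by
      refine List.eq_replicate_iff.2 ⟨rfl, fun b hb => ?_⟩
      simpa using (List.mem_replicate.1 (hv.subset hb)).2
    simp only [List.append_assoc, List.prefix_append_right_inj] at hcomp ⊢
    have hzj : z.length ≤ j := by
      rw [hz] at hcomp
      rcases hcomp with hcomp | hcomp
      · exact absurd hcomp not_replicate_true_prefix
      · exact le_of_replicate_prefix hcomp
    refine ⟨?_, ?_⟩
    · rw [hz]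
      exact (replicate_prefix hzj).trans (List.prefix_append _ _)
    · refine List.prefix_of_prefix_length_le hyx (List.take_prefix _ _) ?_
      have : i ≤ m := by
        by_contra hmi
        have := hm₃ i hi (by omega)
        simp at heq
        omega
      simp; omega

end Step

/-! ### Weights of cells -/

lemma inv_two_pow_succ_add (n : ℕ) :
    (2⁻¹ : ℝ≥0∞) ^ (n + 1) + 2⁻¹ ^ (n + 1) = 2⁻¹ ^ n := by
  rw [pow_succ, ← mul_add, ENNReal.inv_two_add_inv_two, mul_one]

lemma sum_inv_two_pow_le {ι : Type*} (F : Finset ι) (f : ι → ℕ) (hf : Set.InjOn f F) {n : ℕ}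
    (hn : ∀ c ∈ F, n < f c) : ∑ c ∈ F, (2⁻¹ : ℝ≥0∞) ^ f c ≤ 2⁻¹ ^ n := by
  classical
  -- The added power is the missing tail of the geometric series, which makes the identity exact.
  have h : ∀ d, ∑ i ∈ Finset.Ico (n + 1) (n + 1 + d), (2⁻¹ : ℝ≥0∞) ^ i + 2⁻¹ ^ (n + d)
      = 2⁻¹ ^ n := by
    intro d
    induction d with
    | zero => simp
    | succ d ih =>
      rw [← add_assoc (n + 1), Finset.sum_Ico_succ_top (by omega), add_assoc,
        show n + 1 + d = n + d + 1 by omega, ← add_assoc n, inv_two_pow_succ_add,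
        show n + d + 1 = n + 1 + d by omega, ih]
  rw [← Finset.sum_image (f := fun i => (2⁻¹ : ℝ≥0∞) ^ i) hf]
  calc ∑ i ∈ F.image f, (2⁻¹ : ℝ≥0∞) ^ i
      ≤ ∑ i ∈ Finset.Ico (n + 1) (n + 1 + (F.image f).sup id), (2⁻¹ : ℝ≥0∞) ^ i := by
        refine Finset.sum_le_sum_of_subset fun i hi => ?_
        have h₁ : i ≤ (F.image f).sup id := Finset.le_sup (f := id) hi
        obtain ⟨c, hc, rfl⟩ := Finset.mem_image.1 hi
        have := hn c hc
        rw [Finset.mem_Ico]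
        omega
    _ ≤ 2⁻¹ ^ n := by rw [← h]; exact le_self_add

/-- The cells of the same owner have different lengths, which are at least the length of the
owner, and greater if there are several cells. -/
structure IsSpaced (κ : List Bool → ℕ) (D : List Bool → Prop) (s : List Cell) : Prop where
  dom : ∀ a ∈ s, a.2 ≠ [] → D a.2
  le : ∀ a ∈ s, a.2 ≠ [] → κ a.2 ≤ a.1.length
  length_ne : ∀ a ∈ s, ∀ b ∈ s, a ≠ b → a.2 = b.2 → a.1.length ≠ b.1.length
  lt : ∀ a ∈ s, ∀ b ∈ s, a ≠ b → a.2 = b.2 → a.2 ≠ [] → κ a.2 < a.1.length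

section Weight

variable {κ : List Bool → ℕ} {D : List Bool → Prop} {s : List Cell}

/-- The total weight of the cells of the owner `o`. -/
def weight (s : List Cell) (o : List Bool) : ℝ≥0∞ :=
  ∑ c ∈ s.toFinset with c.2 = o, (2⁻¹ : ℝ≥0∞) ^ c.1.length

lemma IsSpaced.weight_le_of_lt (hs : IsSpaced κ D s) {o : List Bool} {n : ℕ}
    (hn : ∀ c ∈ s, c.2 = o → n < c.1.length) : weight s o ≤ 2⁻¹ ^ n := by
  refine sum_inv_two_pow_le _ (fun c : Cell => c.1.length) ?_ ?_
  · intro a ha b hb hab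
    simp only [Finset.coe_filter, List.mem_toFinset, Set.mem_ofPred_eq] at ha hb
    by_contra hne
    exact hs.length_ne a ha.1 b hb.1 hne (ha.2.trans hb.2.symm) hab
  · intro c hc
    rw [Finset.mem_filter, List.mem_toFinset] at hc
    exact hn c hc.1 hc.2

/-- A cell of length exactly `κ o` is the only one; otherwise all lengths are distinct and greater.
-/
lemma IsSpaced.weight_le (hs : IsSpaced κ D s) {o : List Bool} (ho : o ≠ []) :
    weight s o ≤ 2⁻¹ ^ κ o := by
  by_cases h : ∃ c ∈ s, c.2 = o ∧ c.1.length = κ o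
  · obtain ⟨c, hc, rfl, hlen⟩ := h
    have : (s.toFinset.filter fun a => a.2 = c.2) = {c} := by
      ext a
      simp only [Finset.mem_filter, List.mem_toFinset, Finset.mem_singleton]
      constructor
      · rintro ⟨ha, hac⟩
        by_contra hne
        have := hs.lt c hc a ha (Ne.symm hne) hac.symm ho
        omega
      · rintro rfl
        exact ⟨hc, rfl⟩
    rw [weight, this, Finset.sum_singleton, hlen]
  · push Not at h
    refine hs.weight_le_of_lt fun c hc hco => lt_of_le_of_ne ?_ (h c hc hco).symm
    subst hco
    exact hs.le c hc ho

lemma min_add_max_pow (a b : ℕ) :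
    (2⁻¹ : ℝ≥0∞) ^ min a b + 2⁻¹ ^ max a b = 2⁻¹ ^ a + 2⁻¹ ^ b := by
  rcases le_total a b with h | h
  · rw [min_eq_left h, max_eq_right h]
  · rw [min_eq_right h, max_eq_left h, add_comm]

/-- The hypothesis `hx` says that no cell can be split, so the cells of `x.take m` are longer than
any lower bound `n` of K on the longer prefixes. For nonempty owners the weight is therefore at most
2^(-max) of `n` and the owner's K. The induction hypothesis, used with the min, absorbs this because
2^(-min) + 2^(-max) is the sum of the two powers. The empty owner has no bound of its own, hence the
shift of the sum on the right. -/
lemma IsSpaced.sum_weight_path_le (hs : IsSpaced κ D s) {x : List Bool}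
    (hx : ∀ b ∈ s, b.2 <+: x → b.2.length < x.length →
      ∃ i ≤ x.length, b.2.length < i ∧ κ (x.take i) < b.1.length) (m : ℕ) (hm : m < x.length)
    (n : ℕ) (hn : ∀ i ≤ x.length, m < i → n ≤ κ (x.take i)) :
    ∑ i ∈ Finset.range (m + 1), weight s (x.take i) ≤
      2⁻¹ ^ n + ∑ i ∈ Finset.range m, 2⁻¹ ^ κ (x.take (i + 1)) := by
  have hlt : ∀ m < x.length, ∀ n, (∀ i ≤ x.length, m < i → n ≤ κ (x.take i)) →
      ∀ c ∈ s, c.2 = x.take m → n < c.1.length := by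
    intro m hm n hn c hc hcm
    have hl : c.2.length = m := by rw [hcm]; simp; omega
    obtain ⟨i, hi, hci, hlt⟩ := hx c hc (hcm ▸ List.take_prefix _ _) (by omega)
    exact (hn i hi (by omega)).trans_lt hlt
  induction m generalizing n with
  | zero =>
    simpa using hs.weight_le_of_lt (hlt 0 hm n hn)
  | succ m ih =>
    have h₁ := ih (by omega) (min n (κ (x.take (m + 1)))) fun i hi hmi => by
      rcases Nat.lt_or_ge (m + 1) i with h | h
      · exact (min_le_left _ _).trans (hn i hi h)
      · obtain rfl : i = m + 1 := by omega
        exact min_le_right _ _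
    have hne : x.take (m + 1) ≠ [] := by
      intro h
      have := congrArg List.length h
      simp at this
      simp [this] at hm
    have h₂ : weight s (x.take (m + 1)) ≤ 2⁻¹ ^ max n (κ (x.take (m + 1))) := by
      rcases le_total n (κ (x.take (m + 1))) with h | h
      · rw [max_eq_right h]
        exact hs.weight_le hne
      · rw [max_eq_left h]
        exact hs.weight_le_of_lt (hlt (m + 1) hm n hn)
    rw [Finset.sum_range_succ _ (m + 1),
      Finset.sum_range_succ (fun i => (2⁻¹ : ℝ≥0∞) ^ κ (x.take (i + 1))) m]
    calc _ ≤ (2⁻¹ ^ min n (κ (x.take (m + 1))) + ∑ i ∈ Finset.range m, 2⁻¹ ^ κ (x.take (i + 1)))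
          + 2⁻¹ ^ max n (κ (x.take (m + 1))) := add_le_add h₁ h₂
      _ = (2⁻¹ ^ min n (κ (x.take (m + 1))) + 2⁻¹ ^ max n (κ (x.take (m + 1))))
          + ∑ i ∈ Finset.range m, 2⁻¹ ^ κ (x.take (i + 1)) := by
        rw [add_right_comm]
      _ = _ := by rw [min_add_max_pow, add_assoc, add_comm (2⁻¹ ^ κ (x.take (m + 1)))]

/-- If no cell can be split in favour of `x`, then the total weight of all cells is at most the
sum of the weights of all lengths. -/
lemma IsSpaced.sum_le_tsum (hs : IsSpaced κ D s) {x : List Bool} (hx₀ : x ≠ [])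
    (hdom : ∀ i ≤ x.length, D (x.take i)) (hown : ∀ a ∈ s, a.2 ≠ x)
    (hx : ∀ b ∈ s, b.2 <+: x → b.2.length < x.length →
      ∃ i ≤ x.length, b.2.length < i ∧ κ (x.take i) < b.1.length) :
    ∑ c ∈ s.toFinset, (2⁻¹ : ℝ≥0∞) ^ c.1.length ≤ ∑' y : {y // D y}, 2⁻¹ ^ κ y.1 := by
  classical
  have hpos : 0 < x.length := List.length_pos_iff.2 hx₀
  set O := s.toFinset.image Prod.snd with hO
  set P := (Finset.range x.length).image fun i => x.take i with hP
  set P' := (Finset.range x.length).image fun i => x.take (i + 1) with hP'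
  have hinj : Set.InjOn (fun i => x.take i) (Finset.range x.length) := by
    intro i hi j hj hij
    have := congrArg List.length hij
    simp at this hi hj
    omega
  have hinj' : Set.InjOn (fun i => x.take (i + 1)) (Finset.range x.length) := by
    intro i hi j hj hij
    have := congrArg List.length hij
    simp at this hi hj
    omega
  -- The proper prefixes are paid for by the nonempty ones: `x` owns no cell, and its weight
  -- replaces that of the empty string.
  have hpath : ∑ o ∈ P, weight s o ≤ ∑ o ∈ P', 2⁻¹ ^ κ o := by
    rw [hP, hP', Finset.sum_image hinj, Finset.sum_image hinj']
    obtain ⟨m, hm⟩ : ∃ m, x.length = m + 1 := ⟨x.length - 1, by omega⟩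
    have := hs.sum_weight_path_le hx m (by omega) (κ x) fun i hi hmi => by
      rw [List.take_of_length_le (by omega)]
    rw [hm, Finset.sum_range_succ (fun i => (2⁻¹ : ℝ≥0∞) ^ κ (x.take (i + 1)))]
    rw [List.take_of_length_le (l := x) (i := m + 1) (by omega), add_comm _ (2⁻¹ ^ κ x)]
    exact this
  have hrest : ∀ o ∈ O \ P, o ≠ [] ∧ o ≠ x ∧ D o := by
    intro o ho
    rw [Finset.mem_sdiff, hO, Finset.mem_image] at ho
    obtain ⟨⟨c, hc, rfl⟩, hoP⟩ := ho
    rw [List.mem_toFinset] at hc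
    have hne : c.2 ≠ [] := by
      intro h
      exact hoP (Finset.mem_image.2 ⟨0, Finset.mem_range.2 hpos, by simp [h]⟩)
    exact ⟨hne, hown c hc, hs.dom c hc hne⟩
  have hdisj : Disjoint (O \ P) P' := by
    rw [Finset.disjoint_left]
    rintro o ho hoP'
    rw [hP', Finset.mem_image] at hoP'
    obtain ⟨i, hi, rfl⟩ := hoP'
    rw [Finset.mem_range] at hi
    rcases Nat.lt_or_ge (i + 1) x.length with h | h
    · exact (Finset.mem_sdiff.1 ho).2 (Finset.mem_image.2 ⟨i + 1, Finset.mem_range.2 h, rfl⟩)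
    · exact (hrest _ ho).2.1 (List.take_of_length_le h)
  have hD : ∀ o ∈ (O \ P) ∪ P', D o := by
    intro o ho
    rcases Finset.mem_union.1 ho with ho | ho
    · exact (hrest o ho).2.2
    · obtain ⟨i, hi, rfl⟩ := Finset.mem_image.1 ho
      exact hdom _ (Finset.mem_range.1 hi)
  calc ∑ c ∈ s.toFinset, (2⁻¹ : ℝ≥0∞) ^ c.1.length
      = ∑ o ∈ O, weight s o :=
        (Finset.sum_fiberwise_of_maps_to (fun c hc => Finset.mem_image_of_mem _ hc) _).symm
    _ ≤ ∑ o ∈ (O \ P) ∪ P, weight s o := by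
        refine Finset.sum_le_sum_of_subset ?_
        rw [Finset.sdiff_union_self_eq_union]
        exact Finset.subset_union_left
    _ = ∑ o ∈ O \ P, weight s o + ∑ o ∈ P, weight s o :=
        Finset.sum_union Finset.sdiff_disjoint
    _ ≤ ∑ o ∈ O \ P, 2⁻¹ ^ κ o + ∑ o ∈ P', 2⁻¹ ^ κ o :=
        add_le_add (Finset.sum_le_sum fun o ho => hs.weight_le (hrest o ho).1) hpath
    _ = ∑ o ∈ (O \ P) ∪ P', 2⁻¹ ^ κ o := (Finset.sum_union hdisj).symm
    _ = ∑ y ∈ ((O \ P) ∪ P').subtype D, 2⁻¹ ^ κ y.1 :=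
        (Finset.sum_subtype_of_mem (fun o => (2⁻¹ : ℝ≥0∞) ^ κ o) hD).symm
    _ ≤ ∑' y : {y // D y}, 2⁻¹ ^ κ y.1 := ENNReal.sum_le_tsum _

/-- Splitting the best cell preserves the spacing. -/
lemma IsSpaced.split (hs : IsSpaced κ D s) {x : List Bool} {c : Cell}
    (hc : IsBestCell κ D x s c) {s' : List Cell}
    (hs' : ∀ a ∈ s', (a ∈ s ∧ a ≠ c) ∨ IsPart κ x c a) : IsSpaced κ D s' := by
  have hκx := hc.length_le x.length le_rfl hc.owner_lt
  rw [List.take_length] at hκx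
  have hx₀ : x ≠ [] := by rintro rfl; exact absurd hc.owner_lt (by simp)
  -- an old cell and a part of `c` with the same owner
  have hmix : ∀ a b, a ∈ s → a ≠ c → IsPart κ x c b → a.2 = b.2 →
      a.1.length ≠ b.1.length ∧ (a.2 ≠ [] → κ a.2 < a.1.length) := by
    rintro a b ha hac (rfl | ⟨j, hj, m, rfl, hm, hmx, hκm, hlt⟩) hab
    · exact absurd hab (hc.not_owner a ha)
    have hlm : a.2.length = m := by rw [hab]; simp; omega
    rcases hm.eq_or_lt with rfl | hqm
    · have hac2 : a.2 = c.2 := by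
        rw [hab]; exact (List.prefix_iff_eq_take.1 hc.owner_prefix).symm
      have hne := hs.length_ne a ha c hc.mem hac hac2
      refine ⟨fun heq => ?_, hs.lt a ha c hc.mem hac hac2⟩
      -- With equal lengths `a` would be eligible as well and longer than `c`, so `c` would not be
      -- the best.
      have := hc.best a ha (hac2 ▸ hc.owner_prefix) (by omega) fun i hi hi' => by
        have := hlt i hi (by omega)
        simp at heq
        omega
      rcases this with h | ⟨-, h⟩
      · omega
      · simp at heq
        omega
    -- The owner of `a` is longer than that of `c`, so `a` cannot be eligible. This forces `a` to be
    -- longer than the remainder.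
    · have hex : ∃ i ≤ x.length, m < i ∧ κ (x.take i) < a.1.length := by
        by_contra hno
        push Not at hno
        rcases hc.best a ha (hab ▸ List.take_prefix _ _) (by omega) fun i hi hi' =>
          hno i hi (by omega) with h | ⟨h, -⟩ <;> omega
      obtain ⟨i, hi, hmi, hia⟩ := hex
      have h₁ := hlt i hi hmi
      have h₂ := hκm hqm
      refine ⟨by simp; omega, fun _ => ?_⟩
      rw [hab]
      change κ (x.take m) < _
      omega
  -- a remainder of `c`
  have hpart : ∀ b, IsPart κ x c b → b.2 ≠ [] → D b.2 ∧ κ b.2 ≤ b.1.length ∧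
      (b.2 ≠ x → κ b.2 < b.1.length) := by
    rintro b (rfl | ⟨j, hj, m, rfl, hm, hmx, hκm, hlt⟩) hb
    · refine ⟨?_, by simp; omega, fun h => absurd rfl h⟩
      have := hc.dom x.length le_rfl
      rwa [List.take_length] at this
    · have hlt : κ (x.take m) < c.1.length + j + 1 := by
        rcases hm.eq_or_lt with rfl | hqm
        · have heq := (List.prefix_iff_eq_take.1 hc.owner_prefix)
          have := hs.le c hc.mem (by rw [heq]; exact hb)
          rw [← heq]
          omega
        · have := hκm hqm
          omega
      exact ⟨hc.dom m hmx.le, by simp; omega, fun _ => by simp; omega⟩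
  -- two parts of `c`
  have hparts : ∀ a b, IsPart κ x c a → IsPart κ x c b → a ≠ b → a.2 = b.2 →
      a.1.length ≠ b.1.length ∧ a.2 ≠ x := by
    rintro a b (rfl | ⟨j, hj, m, rfl, hm, hmx, -⟩) (rfl | ⟨j', hj', m', rfl, hm', hmx', -⟩) hne hab
    · exact absurd rfl hne
    · have := congrArg List.length hab
      simp at this
      omega
    · have := congrArg List.length hab
      simp at this
      omega
    · refine ⟨fun h => hne ?_, fun h => ?_⟩
      · obtain rfl : j = j' := by simpa using h
        exact Prod.ext rfl hab
      · have := congrArg List.length h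
        simp at this
        omega
  constructor
  · intro a ha ha₀
    rcases hs' a ha with ⟨ha, -⟩ | ha
    · exact hs.dom a ha ha₀
    · exact (hpart a ha ha₀).1
  · intro a ha ha₀
    rcases hs' a ha with ⟨ha, -⟩ | ha
    · exact hs.le a ha ha₀
    · exact (hpart a ha ha₀).2.1
  · intro a ha b hb hne hab
    rcases hs' a ha with ⟨ha, hac⟩ | ha <;> rcases hs' b hb with ⟨hb, hbc⟩ | hb
    · exact hs.length_ne a ha b hb hne hab
    · exact (hmix a b ha hac hb hab).1
    · exact (hmix b a hb hbc ha hab.symm).1.symm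
    · exact (hparts a b ha hb hne hab).1
  · intro a ha b hb hne hab ha₀
    rcases hs' a ha with ⟨ha, hac⟩ | ha <;> rcases hs' b hb with ⟨hb, hbc⟩ | hb
    · exact hs.lt a ha b hb hne hab ha₀
    · exact (hmix a b ha hac hb hab).2 ha₀
    · exact (hpart a ha ha₀).2.2 (hab ▸ hc.not_owner b hb)
    · exact (hpart a ha ha₀).2.2 (hparts a b ha hb hne hab).2

end Weight

section Stages

variable {k : ℕ → List Bool → Option ℕ} {u : ℕ → List Bool → Prop}
  {κ : List Bool → ℕ} {D : List Bool → Prop} {U : Set (List Bool)}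

/-! ### Dead strings -/

lemma Dead.mono (hmono : ∀ m n z, m ≤ n → u m z → u n z) {t t' : ℕ} {v v' : List Bool}
    (h : Dead u t v) (ht : t ≤ t') (hv : v <+: v') : Dead u t' v' := by
  obtain ⟨z, rfl⟩ := hv
  intro w hw
  have hwl := mem_words.1 hw
  obtain ⟨i, hi, hui⟩ := h ((z ++ w).take t) (mem_words.2 (by simp; omega))
  have hi' : i ≤ v.length + t := by
    have : ((z ++ w).take t).length = t := by simp; omega
    rw [List.length_append, this] at hi
    omega
  refine ⟨i, by simp; omega, hmono _ _ _ ht ?_⟩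
  convert hui using 1
  rw [List.append_assoc]
  generalize z ++ w = y
  rw [List.take_append, List.take_append, List.take_take, min_eq_left (by omega)]

lemma Dead.cyl_subset (hu : ∀ t z, u t z → z ∈ U) {t : ℕ} {v : List Bool} (h : Dead u t v) :
    cyl v ⊆ openSet U := by
  intro β hβ
  obtain ⟨w, hw⟩ : v <+: initSeg β (v.length + t) :=
    prefix_initSeg_iff.2 ⟨Nat.le_add_right _ _, hβ⟩
  have hwl : w.length = t := by
    have := congrArg List.length hw
    simpa using this
  obtain ⟨i, hi, hui⟩ := h w (mem_words.2 hwl)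
  rw [hw, length_initSeg] at hi
  rw [hw, take_initSeg _ (by omega)] at hui
  exact ⟨i, hu _ _ hui⟩

lemma exists_dead (hmono : ∀ m n z, m ≤ n → u m z → u n z) (huU : ∀ z ∈ U, ∃ t, u t z)
    {v : List Bool} (h : cyl v ⊆ openSet U) : ∃ t, Dead u t v := by
  -- The bound on the lengths ensures that `t` bits beyond `v` suffice to see the covering string.
  obtain ⟨t, ht⟩ := (isCompact_cyl v).elim_directed_cover
    (fun t => openSet {z | u t z ∧ z.length ≤ t}) (fun t => isOpen_openSet _)
    (fun β hβ => by
      obtain ⟨z, hz, hβz⟩ := mem_openSet.1 (h hβ)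
      obtain ⟨t, ht⟩ := huU z hz
      exact Set.mem_iUnion.2 ⟨max t z.length, mem_openSet.2
        ⟨z, ⟨hmono _ _ _ (le_max_left _ _) ht, le_max_right _ _⟩, hβz⟩⟩)
    (Monotone.directed_le fun s t hst =>
      openSet_mono fun z hz => ⟨hmono _ _ _ hst hz.1, hz.2.trans hst⟩)
  refine ⟨t, fun w hw => ?_⟩
  obtain ⟨β, hβ⟩ := exists_mem_cyl (v ++ w)
  obtain ⟨z, ⟨hz, hzt⟩, hβz⟩ := mem_openSet.1 (ht (cyl_anti (List.prefix_append v w) hβ))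
  have hwl := mem_words.1 hw
  have hle : z.length ≤ (v ++ w).length := by simp; omega
  refine ⟨z.length, by omega, ?_⟩
  rwa [← List.prefix_iff_eq_take.1 (prefix_of_mem_cyl hβz hβ hle)]

/-! ### Invariants of the allocation -/

variable (hk : ∀ t x n, k t x = some n → D x ∧ κ x = n) (hu : ∀ t z, u t z → z ∈ U)

lemma alloc_succ (t : ℕ) : alloc k u (t + 1) = allocStep k u t (alloc k u t) := rfl

include hk in
lemma mem_alloc_succ {t : ℕ} {a : Cell} (ha : a ∈ alloc k u (t + 1)) :
    (a ∈ prune u t (alloc k u t) ∧ ∀ c ∈ event k u t (alloc k u t), a ≠ c) ∨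
      ∃ c ∈ event k u t (alloc k u t), IsPart κ (target t) c a := by
  rw [alloc_succ] at ha
  cases h : event k u t (alloc k u t) with
  | none =>
    rw [allocStep_of_event_none h] at ha
    exact .inl ⟨ha, by simp⟩
  | some c =>
    rcases (mem_allocStep h).1 ha with ⟨h₁, h₂⟩ | h₁
    · exact .inl ⟨h₁, by simpa using h₂⟩
    · exact .inr ⟨c, rfl, isPart_of_mem_splitCell hk h h₁⟩

include hu in
lemma mem_prune_of_notMem {t : ℕ} {s : List Cell} {β : ℕ → Bool} (hβ : β ∉ openSet U)
    {a : Cell} (ha : a ∈ s) (hβa : β ∈ cyl a.1) : a ∈ prune u t s := by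
  classical
  rw [prune, List.mem_filter]
  exact ⟨ha, decide_eq_true fun hd => hβ (hd.cyl_subset hu hβa)⟩

include hu in
-- Pruning loses only points of `U`, and splitting loses none.
lemma exists_mem_alloc {β : ℕ → Bool} (hβ : β ∉ openSet U) (t : ℕ) :
    ∃ a ∈ alloc k u t, β ∈ cyl a.1 := by
  induction t with
  | zero => exact ⟨([], []), by simp [alloc], by simp [cyl_nil]⟩
  | succ t ih =>
    obtain ⟨a, ha, hβa⟩ := ih
    have ha' := mem_prune_of_notMem hu (t := t) hβ ha hβa
    rw [alloc_succ]
    cases h : event k u t (alloc k u t) with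
    | none => exact ⟨a, by rwa [allocStep_of_event_none h], hβa⟩
    | some c =>
      by_cases hac : a = c
      · subst hac
        simp only [mem_allocStep h, splitCell]
        rcases cyl_split hβa (excess k t (target t) a) with h₁ | ⟨j, hj, h₁⟩
        · exact ⟨_, .inr (List.mem_cons_self ..), h₁⟩
        · exact ⟨_, .inr (List.mem_cons_of_mem _ (List.mem_map.2 ⟨j, List.mem_range.2 hj, rfl⟩)), h₁⟩
      · exact ⟨a, (mem_allocStep h).2 (.inl ⟨ha', hac⟩), hβa⟩

include hk in
lemma isSpaced_alloc (t : ℕ) : IsSpaced κ D (alloc k u t) := by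
  induction t with
  | zero => constructor <;> simp [alloc]
  | succ t ih =>
    have hp : IsSpaced κ D (prune u t (alloc k u t)) :=
      ⟨fun a ha => ih.dom a (mem_of_mem_prune ha), fun a ha => ih.le a (mem_of_mem_prune ha),
        fun a ha b hb => ih.length_ne a (mem_of_mem_prune ha) b (mem_of_mem_prune hb),
        fun a ha b hb => ih.lt a (mem_of_mem_prune ha) b (mem_of_mem_prune hb)⟩
    cases h : event k u t (alloc k u t) with
    | none => rwa [alloc_succ, allocStep_of_event_none h]
    | some c =>
      refine hp.split (isBestCell_of_mem_event hk h) fun a ha => ?_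
      rcases mem_alloc_succ hk ha with ⟨h₁, h₂⟩ | ⟨c', hc', h₁⟩
      · exact .inl ⟨h₁, h₂ c h⟩
      · rw [h, Option.mem_some_iff] at hc'
        subst hc'
        exact .inr h₁

include hk in
lemma eq_of_prefix_of_mem_alloc (t : ℕ) : ∀ a ∈ alloc k u t, ∀ b ∈ alloc k u t,
    a.1 <+: b.1 → a = b := by
  induction t with
  | zero => simp [alloc]
  | succ t ih =>
    intro a ha b hb hab
    rcases mem_alloc_succ hk ha with ⟨ha, hac⟩ | ⟨c, hc, ha⟩ <;>
      rcases mem_alloc_succ hk hb with ⟨hb, hbc⟩ | ⟨c', hc', hb⟩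
    · exact ih a (mem_of_mem_prune ha) b (mem_of_mem_prune hb) hab
    · have hbest := isBestCell_of_mem_event hk hc'
      have hp := (hb.prefix hbest.owner_prefix).1
      exfalso
      refine hac c' hc' ?_
      rcases List.prefix_or_prefix_of_prefix hab hp with h | h
      · exact ih a (mem_of_mem_prune ha) c' (mem_of_mem_prune hbest.mem) h
      · exact (ih c' (mem_of_mem_prune hbest.mem) a (mem_of_mem_prune ha) h).symm
    · have hbest := isBestCell_of_mem_event hk hc
      have hp := (ha.prefix hbest.owner_prefix).1
      exact absurd (ih c (mem_of_mem_prune hbest.mem) b (mem_of_mem_prune hb) (hp.trans hab)).symm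
        (hbc c hc)
    · rw [Option.mem_def] at hc hc'
      obtain rfl : c = c' := by rw [hc] at hc'; exact Option.some.inj hc'
      exact ha.eq_of_prefix hb hab

include hk in
-- Once `v` is assigned to `y`, its region belongs to extensions of `y` for ever: later splits stay
-- inside a cell and replace its owner only by extensions.
lemma prefix_of_chunk {t : ℕ} {y v : List Bool} (h : Chunk k u t y v) (d : ℕ) :
    ∀ a ∈ alloc k u (t + 1 + d), a.1 <+: v ∨ v <+: a.1 → v <+: a.1 ∧ y <+: a.2 := by
  induction d with
  | zero =>
    intro a ha hav
    obtain ⟨c, hc, hcv⟩ := (chunk_iff hk).1 h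
    have hbest := isBestCell_of_mem_event hk hc
    rcases mem_alloc_succ hk ha with ⟨ha, hac⟩ | ⟨c', hc', ha⟩
    · have hpre := hcv.cell_prefix hbest
      exfalso
      have h₁ := mem_of_mem_prune ha
      have h₂ := mem_of_mem_prune hbest.mem
      rcases hav with hav | hav
      · rcases List.prefix_or_prefix_of_prefix hav hpre with h | h
        · exact hac c hc (eq_of_prefix_of_mem_alloc hk t a h₁ c h₂ h)
        · exact hac c hc (eq_of_prefix_of_mem_alloc hk t c h₂ a h₁ h).symm
      · exact hac c hc (eq_of_prefix_of_mem_alloc hk t c h₂ a h₁ (hpre.trans hav)).symm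
    · rw [Option.mem_def] at hc hc'
      obtain rfl : c = c' := by rw [hc] at hc'; exact Option.some.inj hc'
      exact hcv.prefix_part hbest ha hav
  | succ d ih =>
    intro a ha hav
    rcases mem_alloc_succ hk ha with ⟨ha, -⟩ | ⟨c, hc, ha⟩
    · exact ih a (mem_of_mem_prune ha) hav
    · have hbest := isBestCell_of_mem_event hk hc
      obtain ⟨h₁, h₂, -⟩ := ha.prefix hbest.owner_prefix
      have hcomp : c.1 <+: v ∨ v <+: c.1 := by
        rcases hav with hav | hav
        · exact .inl (h₁.trans hav)
        · exact List.prefix_or_prefix_of_prefix h₁ hav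
      obtain ⟨h₃, h₄⟩ := ih c (mem_of_mem_prune hbest.mem) hcomp
      exact ⟨h₃.trans h₁, h₄.trans h₂⟩

include hk in
-- A later comparable string would come from a cell meeting `v`, whose owner extends `y`; but a
-- split assigns strings only to targets longer than that owner.
lemma not_comparable_of_lt {t t' : ℕ} (htt : t < t') {y y' v v' : List Bool}
    (hy : y'.length ≤ y.length) (h : Chunk k u t y v) (h' : Chunk k u t' y' v') :
    ¬ (v <+: v' ∨ v' <+: v) := by
  intro hcomp
  obtain ⟨d, rfl⟩ := Nat.exists_eq_add_of_lt htt
  obtain ⟨c, hc, hcv⟩ := (chunk_iff hk).1 h'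
  have hbest := isBestCell_of_mem_event hk hc
  have hpre := hcv.cell_prefix hbest
  have := (prefix_of_chunk hk h d c (by
    rw [add_right_comm]; exact mem_of_mem_prune hbest.mem) ?_).2
  · have := this.length_le
    have := hcv.1
    omega
  · rcases hcomp with hvv | hvv
    · exact List.prefix_or_prefix_of_prefix hpre hvv
    · exact .inl (hpre.trans hvv)

include hk in
/-- Comparable strings that are assigned to strings of the same length coincide. -/
lemma eq_of_chunk {t t' : ℕ} {y y' v v' : List Bool} (hy : y.length = y'.length)
    (h : Chunk k u t y v) (h' : Chunk k u t' y' v') (hcomp : v <+: v' ∨ v' <+: v) :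
    t = t' ∧ y = y' ∧ v = v' := by
  rcases lt_trichotomy t t' with hlt | rfl | hlt
  · exact absurd hcomp (not_comparable_of_lt hk hlt hy.ge h h')
  · obtain ⟨c, hc, hcv⟩ := (chunk_iff hk).1 h
    obtain ⟨c', hc', hcv'⟩ := (chunk_iff hk).1 h'
    rw [Option.mem_def] at hc hc'
    obtain rfl : c = c' := by rw [hc] at hc'; exact Option.some.inj hc'
    exact ⟨rfl, hcv.length_eq hcv' hy⟩
  · exact absurd hcomp.symm (not_comparable_of_lt hk hlt hy.le h' h)

include hk in
lemma length_le_of_chunk {t : ℕ} {y v : List Bool} (h : Chunk k u t y v) :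
    v.length ≤ κ y := by
  obtain ⟨c, hc, -, hy, -, hle, -⟩ := (chunk_iff hk).1 h
  rw [List.prefix_iff_eq_take.1 hy]
  exact hle _ hy.length_le le_rfl

include hk in
lemma exists_chunk_of_mem_alloc (t : ℕ) : ∀ a ∈ alloc k u t, a.2 ≠ [] →
    ∃ t' v, Chunk k u t' a.2 v ∧ v <+: a.1 := by
  induction t with
  | zero => simp [alloc]
  | succ t ih =>
    intro a ha hne
    rcases mem_alloc_succ hk ha with ⟨ha, -⟩ | ⟨c, hc, ha⟩
    · exact ih a (mem_of_mem_prune ha) hne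
    · have hbest := isBestCell_of_mem_event hk hc
      rcases ha with rfl | ⟨j, hj, m, rfl, hm, hmx, hκ, hlt⟩
      · obtain ⟨v, hv, -⟩ := hbest.exists_isAssigned hbest.owner_lt le_rfl
        rw [List.take_length] at hv
        exact ⟨t, v, (chunk_iff hk).2 ⟨c, hc, hv⟩, hv.2.2.1⟩
      · rcases hm.eq_or_lt with rfl | hqm
        · have heq := List.prefix_iff_eq_take.1 hbest.owner_prefix
          rw [← heq] at hne ⊢
          obtain ⟨t', v, hv, hvc⟩ := ih c (mem_of_mem_prune hbest.mem) hne
          exact ⟨t', v, hv, hvc.trans ((List.prefix_append _ _).trans (List.prefix_append _ _))⟩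
        · obtain ⟨v, hv, -, hv'⟩ := hbest.exists_isAssigned hqm hmx.le
          refine ⟨t, v, (chunk_iff hk).2 ⟨c, hc, hv⟩, ?_⟩
          -- The assigned string is no longer than K of the new owner, which is at most `c.1.length
          -- + j`, so it ends before the final 1 of the remainder.
          have h₁ := hv.2.2.2.1 m hmx.le (by simp)
          have h₂ := hκ hqm
          rw [hv', List.append_assoc, List.prefix_append_right_inj]
          exact (replicate_prefix (by omega)).trans (List.prefix_append _ _)

include hk in
/-- A string assigned to `y b` extends a string assigned to `y`. -/
lemma exists_chunk_prefix {t : ℕ} {y v : List Bool} {b : Bool} (hy : y ≠ [])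
    (h : Chunk k u t (y ++ [b]) v) : ∃ t' v', Chunk k u t' y v' ∧ v' <+: v := by
  obtain ⟨c, hc, hcv⟩ := (chunk_iff hk).1 h
  have hbest := isBestCell_of_mem_event hk hc
  have hyx : y <+: target t := (List.prefix_append _ _).trans hcv.2.1
  have hlt : c.2.length ≤ y.length := by have := hcv.1; simp at this; omega
  rcases hlt.eq_or_lt with heq | hlt
  · have hcy : c.2 = y :=
      (List.prefix_of_prefix_length_le hbest.owner_prefix hyx heq.le).eq_of_length heq
    obtain ⟨t', v', hv', hvc⟩ := exists_chunk_of_mem_alloc hk t c (mem_of_mem_prune hbest.mem)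
      (hcy ▸ hy)
    exact ⟨t', v', hcy ▸ hv', hvc.trans (hcv.cell_prefix hbest)⟩
  · obtain ⟨v', hv', -⟩ := hbest.exists_isAssigned hlt hyx.length_le
    rw [← List.prefix_iff_eq_take.1 hyx] at hv'
    refine ⟨t, v', (chunk_iff hk).2 ⟨c, hc, hv'⟩,
      List.prefix_of_prefix_length_le hv'.2.2.1 hcv.2.2.1 ?_⟩
    obtain ⟨-, -, -, -, i, hi, hyi, heq⟩ := hcv
    rw [← heq]
    exact hv'.2.2.2.1 i hi (by simp at hyi; omega)

/-! ### The allocation never fails -/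

variable (hsum : coinMeasure (openSet U) + ∑' y : {y // D y}, (2⁻¹ : ℝ≥0∞) ^ κ y.1 < 1)

lemma exists_chosen {t : ℕ} {x : List Bool} {s : List Cell}
    (h : ∃ a ∈ s, Eligible k t x a) : ∃ c, c ∈ chosen k t x s := by
  classical
  obtain ⟨a, ha, hae⟩ := h
  obtain ⟨c, hc, hmax⟩ := Finset.exists_max_image (s.toFinset.filter (Eligible k t x))
    -- `RankLE` is the lexicographic order on these pairs.
    (fun c => toLex (c.2.length, c.1.length))
    ⟨a, Finset.mem_filter.2 ⟨List.mem_toFinset.2 ha, hae⟩⟩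
  rw [Finset.mem_filter, List.mem_toFinset] at hc
  have hmem : c ∈ (s.filter fun c => decide (Eligible k t x c)).filter fun a =>
      decide (∀ b ∈ s.filter fun c => decide (Eligible k t x c), RankLE b a) := by
    simp only [List.mem_filter, decide_eq_true_eq]
    refine ⟨hc, fun b hb => ?_⟩
    have := hmax b (Finset.mem_filter.2 ⟨List.mem_toFinset.2 hb.1, hb.2⟩)
    simpa [RankLE, Prod.Lex.toLex_le_toLex] using this
  unfold chosen
  cases hh : List.head? _ with
  | none => rw [List.head?_eq_none_iff] at hh; rw [hh] at hmem; simp at hmem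
  | some c' => exact ⟨c', rfl⟩

include hk hu hsum in
lemma exists_mem_event {t : ℕ} (hne : target t ≠ [])
    (hr : Ready k t (target t) (prune u t (alloc k u t))) :
    ∃ c, c ∈ event k u t (alloc k u t) := by
  classical
  rw [event, if_pos hr]
  apply exists_chosen
  by_contra hno
  push Not at hno
  have hl := fun i (hi : i ≤ (target t).length) => lengthAt_eq hk hr hi
  have hs := isSpaced_alloc (u := u) hk t
  have hp : IsSpaced κ D (prune u t (alloc k u t)) :=
    ⟨fun a ha => hs.dom a (mem_of_mem_prune ha), fun a ha => hs.le a (mem_of_mem_prune ha),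
      fun a ha b hb => hs.length_ne a (mem_of_mem_prune ha) b (mem_of_mem_prune hb),
      fun a ha b hb => hs.lt a (mem_of_mem_prune ha) b (mem_of_mem_prune hb)⟩
  have hle := hp.sum_le_tsum hne (fun i hi => (hl i hi).1) hr.2 fun b hb h₁ h₂ => by
    by_contra hcon
    push Not at hcon
    refine hno b hb ⟨h₁, h₂, fun i hi hbi => ?_⟩
    rw [(hl i (by omega)).2]
    exact hcon i (by omega) hbi
  have hcover : (Set.univ : Set (ℕ → Bool)) ⊆
      openSet U ∪ ⋃ c ∈ (prune u t (alloc k u t)).toFinset, cyl c.1 := by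
    intro β _
    by_cases hβ : β ∈ openSet U
    · exact .inl hβ
    · obtain ⟨a, ha, hβa⟩ := exists_mem_alloc hu hβ t
      refine .inr ?_
      simp only [Set.mem_iUnion, List.mem_toFinset]
      exact ⟨a, mem_prune_of_notMem hu hβ ha hβa, hβa⟩
  refine absurd hsum (not_lt.2 ?_)
  calc 1 = coinMeasure Set.univ := measure_univ.symm
    _ ≤ coinMeasure (openSet U) +
        coinMeasure (⋃ c ∈ (prune u t (alloc k u t)).toFinset, cyl c.1) :=
      (measure_mono hcover).trans (measure_union_le _ _)
    _ ≤ coinMeasure (openSet U) +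
        ∑ c ∈ (prune u t (alloc k u t)).toFinset, coinMeasure (cyl c.1) := by
      gcongr
      exact measure_biUnion_finset_le _ _
    _ ≤ _ := by
      simp only [coinMeasure_cyl]
      gcongr

/-! ### Every string with lengths keeps a string outside the dead part -/

variable (hkD : ∀ x, D x → ∃ N, ∀ t ≥ N, (k t x).isSome)
  (hmono : ∀ m n z, m ≤ n → u m z → u n z) (huU : ∀ z ∈ U, ∃ t, u t z)

include hk in
lemma finite_chunks (y : List Bool) : {v | ∃ t, Chunk k u t y v}.Finite := by
  refine (List.finite_length_le Bool (κ y)).subset ?_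
  rintro v ⟨t, h⟩
  exact length_le_of_chunk hk h

include hk hu hsum hkD hmono huU in
lemma exists_chunk_not_subset {x : List Bool} (hx₀ : x ≠ [])
    (hx : ∀ i ≤ x.length, D (x.take i)) :
    ∃ t v, Chunk k u t x v ∧ ¬ cyl v ⊆ openSet U := by
  classical
  by_contra hno
  push Not at hno
  have hfin := finite_chunks (u := u) hk x
  have hdead : ∃ N, ∀ v, (∃ t, Chunk k u t x v) → Dead u N v := by
    have : ∀ v, ∃ N, (∃ t, Chunk k u t x v) → Dead u N v := by
      intro v
      by_cases hv : ∃ t, Chunk k u t x v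
      · obtain ⟨t, ht⟩ := hv
        obtain ⟨N, hN⟩ := exists_dead hmono huU (hno t v ht)
        exact ⟨N, fun _ => hN⟩
      · exact ⟨0, fun h => absurd h hv⟩
    choose N hN using this
    refine ⟨hfin.toFinset.sup N, fun v hv => (hN v hv).mono hmono ?_ List.prefix_rfl⟩
    exact Finset.le_sup (hfin.mem_toFinset.2 hv)
  obtain ⟨N₁, hN₁⟩ := hdead
  have hlen : ∃ N, ∀ t ≥ N, ∀ i < x.length + 1, (k t (x.take i)).isSome := by
    have : ∀ i, ∃ N, i ≤ x.length → ∀ t ≥ N, (k t (x.take i)).isSome := by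
      intro i
      by_cases hi : i ≤ x.length
      · obtain ⟨N, hN⟩ := hkD _ (hx i hi)
        exact ⟨N, fun _ => hN⟩
      · exact ⟨0, fun h => absurd h hi⟩
    choose N hN using this
    refine ⟨(Finset.range (x.length + 1)).sup N, fun t ht i hi => hN i (by omega) t ?_⟩
    exact (Finset.le_sup (f := N) (Finset.mem_range.2 hi)).trans ht
  obtain ⟨N₂, hN₂⟩ := hlen
  -- After both thresholds any cell of `x` would lie in a dead string and be pruned, so `x` is ready
  -- whenever it is the target.
  have hserve : ∀ n, ∃ v, Chunk k u (Nat.pair (max N₁ N₂ + n) (encode x)) x v := by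
    intro n
    set t := Nat.pair (max N₁ N₂ + n) (encode x) with ht
    have htn : max N₁ N₂ ≤ t := (Nat.le_add_right _ _).trans (Nat.left_le_pair _ _)
    have htx : target t = x := by simp [target, ht]
    have hr : Ready k t (target t) (prune u t (alloc k u t)) := by
      rw [htx]
      refine ⟨hN₂ t ((le_max_right _ _).trans htn), fun c hc hcx => ?_⟩
      obtain ⟨t', v, hv, hvc⟩ := exists_chunk_of_mem_alloc hk t c (mem_of_mem_prune hc)
        (hcx ▸ hx₀)
      rw [hcx] at hv
      have hd := (hN₁ v ⟨t', hv⟩).mono hmono ((le_max_left _ _).trans htn) hvc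
      rw [prune, List.mem_filter, decide_eq_true_eq] at hc
      exact hc.2 hd
    obtain ⟨c, hc⟩ := exists_mem_event hk hu hsum (by rwa [htx]) hr
    have hbest := isBestCell_of_mem_event hk hc
    obtain ⟨v, hv, -⟩ := hbest.exists_isAssigned hbest.owner_lt le_rfl
    rw [List.take_length, htx] at hv
    exact ⟨v, (chunk_iff hk).2 ⟨c, hc, by rwa [htx]⟩⟩
  choose v hv using hserve
  have hmem : ∀ n, v n ∈ {v | ∃ t, Chunk k u t x v} := fun n => ⟨_, hv n⟩
  refine Set.infinite_of_injective_forall_mem (fun m n hmn => ?_) hmem hfin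
  -- Equal strings force equal stages, so infinitely many distinct strings are assigned to `x`.
  have := (eq_of_chunk hk rfl (hv m) (hv n) (.inl (hmn ▸ List.prefix_rfl))).1
  simpa using this

include hk hu hsum hkD hmono huU in
theorem exists_oracle {α : ℕ → Bool} (hα : ∀ n, D (initSeg α n)) :
    ∃ β, β ∉ openSet U ∧ ∀ n, ∃ t v, Chunk k u t (initSeg α (n + 1)) v ∧ β ∈ cyl v := by
  -- The sets start with prefixes of length 1, as nothing is ever assigned to the empty string. They
  -- decrease because assigned strings nest.
  set Ω : ℕ → Set (ℕ → Bool) := fun n =>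
    ⋃ v ∈ {v | ∃ t, Chunk k u t (initSeg α (n + 1)) v}, cyl v with hΩ
  have hmem : ∀ n β, β ∈ Ω n ↔ ∃ t v, Chunk k u t (initSeg α (n + 1)) v ∧ β ∈ cyl v := by
    intro n β
    simp only [hΩ, Set.mem_iUnion, Set.mem_ofPred_eq, exists_prop]
    constructor
    · rintro ⟨v, ⟨t, h⟩, hβ⟩
      exact ⟨t, v, h, hβ⟩
    · rintro ⟨t, v, h, hβ⟩
      exact ⟨v, ⟨t, h⟩, hβ⟩
  have hclosed : ∀ n, IsClosed (Ω n \ openSet U) := fun n =>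
    ((finite_chunks hk _).isClosed_biUnion fun v _ => (isClopen_cyl v).1).sdiff (isOpen_openSet U)
  have hne : (⋂ n, Ω n \ openSet U).Nonempty := by
    refine IsCompact.nonempty_iInter_of_sequence_nonempty_isCompact_isClosed _ (fun n β hβ => ?_)
      (fun n => ?_) (hclosed 0).isCompact hclosed
    · refine ⟨?_, hβ.2⟩
      obtain ⟨t, v, hv, hβv⟩ := (hmem _ _).1 hβ.1
      rw [initSeg_succ] at hv
      obtain ⟨t', v', hv', hvv⟩ := exists_chunk_prefix hk
        (by intro h; simpa using congrArg List.length h) hv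
      exact (hmem _ _).2 ⟨t', v', hv', cyl_anti hvv hβv⟩
    · obtain ⟨t, v, hv, hsub⟩ := exists_chunk_not_subset hk hu hsum hkD hmono huU
        (x := initSeg α (n + 1)) (by intro h; simpa using congrArg List.length h)
        (fun i hi => by rw [take_initSeg _ (by simpa using hi)]; exact hα i)
      obtain ⟨β, hβv, hβ⟩ := Set.not_subset.1 hsub
      exact ⟨β, (hmem _ _).2 ⟨t, v, hv, hβv⟩, hβ⟩
  obtain ⟨β, hβ⟩ := hne
  rw [Set.mem_iInter] at hβ
  exact ⟨β, (hβ 0).2, fun n => (hmem n β).1 (hβ n).1⟩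

end Stages

/-- Every partial computable function is the limit of primitive recursive approximations. -/
lemma exists_length_stages {K : List Bool →. ℕ} (hK : Partrec K) :
    ∃ k : ℕ → List Bool → Option ℕ, Primrec₂ k ∧ (∀ t x n, k t x = some n → n ∈ K x) ∧
      ∀ x, (K x).Dom → ∃ N, ∀ t ≥ N, (k t x).isSome := by
  obtain ⟨c, hc⟩ := exists_code_eval hK
  refine ⟨fun t x => Code.evaln t c (encode x), ?_, fun t x n h => ?_, fun x hx => ?_⟩
  · exact Code.primrec_evaln.comp (Primrec.pair (Primrec.pair Primrec.fst (Primrec.const c))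
      (Primrec.encode.comp Primrec.snd))
  · have := Code.evaln_sound h
    rw [hc] at this
    simpa using this
  · obtain ⟨N, hN⟩ := dom_eval_iff (c := c) (x := encode x).1 (by rw [hc]; exact hx)
    exact ⟨N, fun t ht => isSome_evaln_mono ht hN⟩

end RandomReduction

end

/-! ### Assembly of the reduction -/

theorem mainTheorem5 (K : List Bool →. ℕ) (hK : Partrec K)
    (hsum : ∑' x : {x : List Bool // (K x).Dom}, (2⁻¹ : ℝ≥0∞) ^ (K x.1).get x.2 < 1) :
    ∃ M : RandomReduction.OracleMachine,
      ∀ α : ℕ → Bool, (∀ n, (K (RandomReduction.initSeg α n)).Dom) →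
        ∃ β : ℕ → Bool, RandomReduction.IsMartinLofRandom β ∧
          M.Computes β α ∧
          ∀ n, ∃ u ∈ M.oracleUse β n, ∃ k ∈ K (RandomReduction.initSeg α n), u ≤ k := by
  classical
  open RandomReduction in
  obtain ⟨k, hkp, hkK, hkD⟩ := exists_length_stages hK
  obtain ⟨c, hc⟩ := ENNReal.exists_inv_two_pow_lt (tsub_pos_of_lt hsum).ne'
  obtain ⟨u, hup, hmono, huU⟩ := exists_stages (rePred_universalSet c)
  set κ : List Bool → ℕ := fun x => if h : (K x).Dom then (K x).get h else 0 with hκ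
  have hk : ∀ t x n, k t x = some n → (K x).Dom ∧ κ x = n := by
    intro t x n h
    obtain ⟨hd, hn⟩ := hkK t x n h
    exact ⟨hd, by simp only [hκ, dif_pos hd]; exact hn⟩
  have hu : ∀ t z, u t z → z ∈ universalSet c := fun t z h => (huU z).2 ⟨t, h⟩
  have hsum' : coinMeasure (openSet (universalSet c)) +
      ∑' y : {y // (K y).Dom}, (2⁻¹ : ℝ≥0∞) ^ κ y.1 < 1 := by
    have heq : ∑' y : {y // (K y).Dom}, (2⁻¹ : ℝ≥0∞) ^ κ y.1 =
        ∑' x : {x : List Bool // (K x).Dom}, (2⁻¹ : ℝ≥0∞) ^ (K x.1).get x.2 :=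
      tsum_congr fun y => by simp only [hκ, dif_pos y.2]
    rw [heq]
    exact lt_tsub_iff_right.1 ((coinMeasure_universalSet_le c).trans_lt hc)
  have hr := primrec_chunk hkp hup
  have hpf : ∀ s s' y b b' v v', Chunk k u s (y ++ [b]) v → Chunk k u s' (y ++ [b']) v' →
      v <+: v' → b = b' ∧ v = v' := by
    intro s s' y b b' v v' h h' hv
    obtain ⟨-, h₁, h₂⟩ := eq_of_chunk hk (by simp) h h' (.inl hv)
    exact ⟨by simpa using h₁, h₂⟩
  refine ⟨follower _ hr, fun α hα => ?_⟩
  obtain ⟨β, hβU, hβ⟩ := exists_oracle hk hu hsum' hkD hmono (fun z hz => (huU z).1 hz) hα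
  choose s T hT hβT using hβ
  have hlen : ∀ n, (T n).length ≤ (T (n + 1)).length := by
    intro n
    have h := hT (n + 1)
    rw [initSeg_succ] at h
    obtain ⟨t', v', hv', hvT⟩ := exists_chunk_prefix hk
      (by intro h; simpa using congrArg List.length h) h
    -- Both are prefixes of `β`, hence comparable, and being assigned to the same string they
    -- coincide.
    have hcomp : v' <+: T n ∨ T n <+: v' := (le_total _ _).imp
      (prefix_of_mem_cyl (cyl_anti hvT (hβT _)) (hβT n))
      (prefix_of_mem_cyl (hβT n) (cyl_anti hvT (hβT _)))
    rw [← (eq_of_chunk hk rfl hv' (hT n) hcomp).2.2]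
    exact hvT.length_le
  have hT' : ∀ n, ∃ s, Chunk k u s (initSeg α (n + 1)) (T n) := fun n => ⟨_, hT n⟩
  refine ⟨β, isMartinLofRandom_of_notMem c hβU, follower_computes hr hpf hT' hβT hlen, ?_⟩
  rintro (_ | n)
  · exact ⟨0, zero_mem_oracleUse_zero _ β, _, Part.get_mem (hα 0), Nat.zero_le _⟩
  · obtain ⟨m, hm, hle⟩ := follower_oracleUse_succ hr hpf hT' hβT hlen n
    refine ⟨m, hm, _, Part.get_mem (hα (n + 1)), hle.trans ?_⟩
    simpa only [hκ, dif_pos (hα (n + 1))] using length_le_of_chunk hk (hT n)
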